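/- **Setting.** Let $A(x)=A_0+\sum_{p=1}^n x_pA_p$ and $B(x)=B_0+\sum_{p=1}^n x_pB_p$ be linear pencils with real symmetric coefficients of sizes $k\times k$ and $l\times l$; $S_A=\{x\in\mathbb R^n: A(x)\succeq 0\}$, likewise $S_B$. Let $\widehat A(x)=1\oplus A(x)$ be the extended pencil, with coefficients $\widehat A_0=1\oplus A_0$ and $\widehat A_p=0\oplus A_p$ $(p\ge 1)$, and let $\mathcal A=\mathrm{span}(A_0,\dots,A_n)$, $\widehat{\mathcal A}=\mathrm{span}(\widehat A_0,\dots,\widehat A_n)$, $\mathcal B=\mathrm{span}(B_0,\dots,B_n)$. *Maps.* If $A_1,\dots,A_n$ are linearly independent, $\widehat\Phi_{AB}:\widehat{\mathcal A}\to\mathcal B$ is the linear map with $\widehat A_p\mapsto B_p$ $(0\le p\le n)$; if $A_0,\dots,A_n$ are linearly independent, $\Phi_{AB}:\mathcal A\to\mathcal B$ is the linear map with $A_p\mapsto B_p$ $(0\le p\le n)$. A linear map $\Phi$ between matrix subspaces is positive if it maps positive semidefinite (PSD) matrices to PSD matrices, and completely positive if, for every $d\ge1$, it maps each PSD block matrix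 $(X_{ij})_{i,j=1}^d$ with blocks in its domain to a PSD block matrix $(\Phi(X_{ij}))_{i,j=1}^d$. *SDFP.* The SDFP for $(A,B)$ asks for a PSD block matrix $C=(C_{ij})_{i,j=1}^k$ with $l\times l$ blocks such that $B_p=\sum_{i,j}(A_p)_{ij}C_{ij}$ for $p=0,\dots,n$; the SDFP for $(\widehat A,B)$ is the same with $\widehat A_p$ (of size $k+1$) in place of $A_p$. *Sum-of-squares program.* A polynomial matrix is an sos-matrix if it equals $UU^T$ for some polynomial matrix $U$. For $t\ge 0$, $\lambda\in\mathbb R$ is feasible for the order-$t$ program if there is an sos-matrix $S(x)=(S_{ij}(x))_{i,j=1}^l$ with $k\times k$ blocks and entries of degree at most $2t$ such that $B(x)-\lambda I_l-(\langle S_{ij}(x),A(x)\rangle)_{i,j=1}^l$ is an sos-matrix; $\lambda_{\rm sos}(t)\in[-\infty,\infty]$ is the supremum of all feasible $\lambda$. *Moment relaxation.* Fix $0<r\le R$ and let $G_A(x,z)=\mathrm{diag}(A(x),\,z^Tz-r^2,\,R^2-z^Tz)$ with $z=(z_1,\dots,z_l)$. For a real sequence $y$ indexed by the monomials in $(x,z)$,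 let $L_y$ be the linear functional on $\mathbb R[x,z]$ sending each monomial to its entry of $y$, and let $[x,z]_t$ be the vector of monomials of degree at most $t$. For $t\ge2$, $\mu_{\rm mom}(t)\in[-\infty,\infty]$ is the infimum of $L_y(z^TB(x)z)$ over all $y$ with $L_y(1)=1$, $L_y([x,z]_t[x,z]_t^T)\succeq0$ and $L_y([x,z]_{t-1}[x,z]_{t-1}^T\otimes G_A)\succeq0$. **Theorem.** Assume $S_A\neq\emptyset$, and consider - (1') $\widehat\Phi_{AB}$ is completely positive; - (1) the SDFP for $(\widehat A,B)$ has a PSD solution; - (2') $\lambda_{\rm sos}(0)\ge0$; - (2) $\mu_{\rm mom}(2)\ge0$; - (3) $S_A\subseteq S_B$; - (3') $\widehat\Phi_{AB}$ is positive. Here (1') and (3') are considered only when $A_1,\dots,A_n$ are linearly independent. Then $$(1')\Longleftarrow(1)\Longrightarrow(2')\Longrightarrow(2)\Longrightarrow(3)\Longleftrightarrow(3').$$ Moreover, (1) holds if and only if some $\lambda\ge0$ is feasible for the order-$0$ sum-of-squares program. If $\widehat{\mathcal A}$ contains a positive definite matrix, then $(1')\Leftrightarrow(1)\Leftrightarrow(2')$.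 Condition (2') implies $\lambda_{\rm sos}(t)\ge0$ for all $t\ge0$, and (2) implies $\mu_{\rm mom}(t)\ge0$ for all $t\ge2$. Solvability of the SDFP for $(A,B)$ implies (1). If in addition $S_A$ is bounded and $A_0,\dots,A_n$ are linearly independent, then (1) is equivalent to solvability of the SDFP for $(A,B)$, and all of the above statements about (1') and (3') hold with $\Phi_{AB}$ in place of $\widehat\Phi_{AB}$. -/

import Mathlib

noncomputable section

/-- A linear (matrix) pencil `A(x) = A₀ + x₁ A₁ + ⋯ + xₙ Aₙ` with real symmetric coefficient
matrices, rows and columns indexed by `ι`. The constant coefficient is `coeff 0`, and the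
coefficient of the `p`-th variable (`p : Fin n`) is `coeff p.succ`. -/
structure LinearPencil (n : ℕ) (ι : Type) where
  coeff : Fin (n + 1) → Matrix ι ι ℝ
  symm : ∀ p, (coeff p).IsSymm

namespace LinearPencil

variable {n : ℕ} {ι κ : Type}

/-- The matrix `A(x)` at a point `x ∈ ℝⁿ`. -/
def eval (A : LinearPencil n ι) (x : Fin n → ℝ) : Matrix ι ι ℝ :=
  A.coeff 0 + ∑ p : Fin n, x p • A.coeff p.succ

/-- The spectrahedron `S_A = {x ∈ ℝⁿ : A(x) ⪰ 0}`. -/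
def spectrahedron (A : LinearPencil n ι) : Set (Fin n → ℝ) :=
  {x | (A.eval x).PosSemidef}

/-- `A(x)` as a matrix of polynomials in variables indexed by `σ`, where the variable of the pencil
with index `p` is the polynomial variable with index `v p`. -/
def toPoly {σ : Type} (A : LinearPencil n ι) (v : Fin n → σ) : Matrix ι ι (MvPolynomial σ ℝ) :=
  (A.coeff 0).map MvPolynomial.C +
    ∑ p : Fin n, (MvPolynomial.X (v p) : MvPolynomial σ ℝ) • (A.coeff p.succ).map MvPolynomial.C

/-- The extended linear pencil `1 ⊕ A(x) = (1 ⊕ A₀) + ∑ₚ xₚ (0 ⊕ Aₚ)`. -/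
def extend (A : LinearPencil n ι) : LinearPencil n (Unit ⊕ ι) where
  coeff p := Matrix.fromBlocks (if p = 0 then 1 else 0) 0 0 (A.coeff p)
  symm p := by
    refine Matrix.IsSymm.fromBlocks ?_ (by simp) (A.symm p)
    split_ifs
    · exact Matrix.isSymm_one
    · exact Matrix.isSymm_zero

/-- The linear span `𝒜 = lin(A₀, …, Aₙ)` of the coefficient matrices. -/
abbrev coeffSpan (A : LinearPencil n ι) : Submodule ℝ (Matrix ι ι ℝ) :=
  Submodule.span ℝ (Set.range A.coeff)

/-- For linearly independent `A₀, …, Aₙ`, the linear map `Φ_AB : 𝒜 → ℬ` with `Aₚ ↦ Bₚ` for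
`p = 0, …, n`. -/
def coeffMap (A : LinearPencil n ι) (B : LinearPencil n κ) (hA : LinearIndependent ℝ A.coeff) :
    A.coeffSpan →ₗ[ℝ] B.coeffSpan :=
  (Module.Basis.span hA).constr ℝ fun p => ⟨B.coeff p, Submodule.subset_span ⟨p, rfl⟩⟩

theorem coeffMap_coeff (A : LinearPencil n ι) (B : LinearPencil n κ)
    (hA : LinearIndependent ℝ A.coeff) (p : Fin (n + 1)) :
    (A.coeffMap B hA ⟨A.coeff p, Submodule.subset_span ⟨p, rfl⟩⟩ : Matrix κ κ ℝ) = B.coeff p := by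
  have h : (⟨A.coeff p, Submodule.subset_span ⟨p, rfl⟩⟩ : A.coeffSpan) = Module.Basis.span hA p :=
    (Module.Basis.span_apply hA p).symm
  rw [h, coeffMap, Module.Basis.constr_basis]

/-- If `A₁, …, Aₙ` are linearly independent, then so are the coefficients
`1 ⊕ A₀, 0 ⊕ A₁, …, 0 ⊕ Aₙ` of the extended pencil. -/
theorem linearIndependent_extend (A : LinearPencil n ι)
    (hA : LinearIndependent ℝ fun p : Fin n => A.coeff p.succ) :
    LinearIndependent ℝ A.extend.coeff := by
  rw [Fintype.linearIndependent_iff] at hA ⊢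
  intro g hg
  have h0 : g 0 = 0 := by
    have h := congrFun (congrFun hg (Sum.inl ())) (Sum.inl ())
    rw [Fin.sum_univ_succ] at h
    simpa [extend, Matrix.add_apply, Matrix.sum_apply, Fin.succ_ne_zero] using h
  refine Fin.cases h0 (hA (fun p => g p.succ) ?_)
  ext i j
  have h := congrFun (congrFun hg (Sum.inr i)) (Sum.inr j)
  rw [Fin.sum_univ_succ, h0] at h
  simpa [extend, Matrix.add_apply, Matrix.sum_apply] using h

/-- For linearly independent `A₁, …, Aₙ`, the linear map `Φ̂_AB` from the span of the coefficients of
the extended pencil to `ℬ`, with `1 ⊕ A₀ ↦ B₀` and `0 ⊕ Aₚ ↦ Bₚ` for `p = 1, …, n`. -/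
def extendedMap (A : LinearPencil n ι) (B : LinearPencil n κ)
    (hA : LinearIndependent ℝ fun p : Fin n => A.coeff p.succ) :
    A.extend.coeffSpan →ₗ[ℝ] B.coeffSpan :=
  A.extend.coeffMap B (A.linearIndependent_extend hA)

/-- Solvability of the semidefinite feasibility problem for `A` and `B`: there is a positive
semidefinite block matrix `C = (C_ij)` with `B_p = ∑_{i,j} (A_p)_ij C_ij` for `p = 0, …, n`. -/
def SDFPSolvable [Fintype ι] (A : LinearPencil n ι) (B : LinearPencil n κ) : Prop :=
  ∃ C : Matrix ι ι (Matrix κ κ ℝ), (Matrix.comp ι ι κ κ ℝ C).PosSemidef ∧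
    ∀ p, B.coeff p = ∑ i, ∑ j, A.coeff p i j • C i j

end LinearPencil

section MatrixMaps

variable {ι κ : Type} {𝒜 : Submodule ℝ (Matrix ι ι ℝ)} {ℬ : Submodule ℝ (Matrix κ κ ℝ)}

/-- A linear map between matrix subspaces is positive if it maps positive semidefinite matrices to
positive semidefinite matrices. -/
def IsPositiveMap (Φ : 𝒜 →ₗ[ℝ] ℬ) : Prop :=
  ∀ X : 𝒜, (X : Matrix ι ι ℝ).PosSemidef → (Φ X : Matrix κ κ ℝ).PosSemidef

/-- `Φ` is `d`-positive if `(Φ(A_ij))` is positive semidefinite for every positive semidefinite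
`d × d` block matrix `(A_ij)` with blocks in `𝒜`. -/
def IsDPositiveMap (d : ℕ) (Φ : 𝒜 →ₗ[ℝ] ℬ) : Prop :=
  ∀ X : Fin d → Fin d → 𝒜,
    (Matrix.comp (Fin d) (Fin d) ι ι ℝ (Matrix.of fun i j => (X i j : Matrix ι ι ℝ))).PosSemidef →
    (Matrix.comp (Fin d) (Fin d) κ κ ℝ
      (Matrix.of fun i j => (Φ (X i j) : Matrix κ κ ℝ))).PosSemidef

/-- `Φ` is completely positive if it is `d`-positive for all positive integers `d`. -/
def IsCompletelyPositiveMap (Φ : 𝒜 →ₗ[ℝ] ℬ) : Prop :=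
  ∀ d : ℕ, 0 < d → IsDPositiveMap d Φ

end MatrixMaps

/-- The subspace `𝒜` contains a positive definite matrix. -/
def ContainsPosDef {ι : Type} (𝒜 : Submodule ℝ (Matrix ι ι ℝ)) : Prop :=
  ∃ X ∈ 𝒜, X.PosDef

section Sos

/-- A symmetric polynomial matrix is a sum of squares if it is `U Uᵀ` for a polynomial matrix `U`
with some positive number `m` of columns. -/
def IsSosMatrix {σ ι : Type} (M : Matrix ι ι (MvPolynomial σ ℝ)) : Prop :=
  ∃ m : ℕ, 0 < m ∧ ∃ U : Matrix ι (Fin m) (MvPolynomial σ ℝ), M = U * U.transpose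

variable {n : ℕ} {ι κ : Type} [Fintype ι] [DecidableEq κ]

/-- `lam` is feasible for the sum-of-squares program of order `t`: there is an sos-matrix
`S(x) = (S_ij(x))`, with `κ × κ` blocks of size `ι × ι` and entries of degree at most `2t`, such
that `B(x) - lam I - (⟨S_ij(x), A(x)⟩)_ij` is an sos-matrix. -/
def SosFeasible (A : LinearPencil n ι) (B : LinearPencil n κ) (t : ℕ) (lam : ℝ) : Prop :=
  ∃ S : Matrix κ κ (Matrix ι ι (MvPolynomial (Fin n) ℝ)),
    (∀ i j a b, (S i j a b).totalDegree ≤ 2 * t) ∧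
    IsSosMatrix (Matrix.comp κ κ ι ι (MvPolynomial (Fin n) ℝ) S) ∧
    IsSosMatrix (B.toPoly id - (MvPolynomial.C lam : MvPolynomial (Fin n) ℝ) • 1 -
      Matrix.of fun i j => ∑ a, ∑ b, S i j a b * A.toPoly id a b)

/-- The optimal value `λ_sos(t)`, the supremum of the feasible `lam`, in the extended reals. -/
def lambdaSos (A : LinearPencil n ι) (B : LinearPencil n κ) (t : ℕ) : EReal :=
  ⨆ (lam : ℝ) (_ : SosFeasible A B t lam), (lam : EReal)

end Sos

section Moments

open MvPolynomial

variable {σ : Type}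

/-- The linearization `L_y(p) = ∑_α p_α y_α`. -/
def linearize (y : (σ →₀ ℕ) → ℝ) (p : MvPolynomial σ ℝ) : ℝ :=
  ∑ α ∈ p.support, p.coeff α * y α

/-- The truncated moment matrix `M_t(y)` with entries `y_{α+β}` for `|α|, |β| ≤ t`. -/
def momentMatrix (t : ℕ) (y : (σ →₀ ℕ) → ℝ) :
    Matrix {α : σ →₀ ℕ // α.degree ≤ t} {α : σ →₀ ℕ // α.degree ≤ t} ℝ :=
  Matrix.of fun α β => y (α.1 + β.1)

/-- The truncated localizing matrix `M_t(Gy) = L_y([x]_t [x]_tᵀ ⊗ G(x))`. -/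
def localizingMatrix {ι : Type} (t : ℕ) (G : Matrix ι ι (MvPolynomial σ ℝ))
    (y : (σ →₀ ℕ) → ℝ) :
    Matrix ({α : σ →₀ ℕ // α.degree ≤ t} × ι) ({α : σ →₀ ℕ // α.degree ≤ t} × ι) ℝ :=
  Matrix.of fun a b => linearize y (monomial (a.1.1 + b.1.1) 1 * G a.2 b.2)

variable {n : ℕ} {ι κ : Type} [Fintype κ]

/-- `zᵀ z`, in the polynomial ring in the variables `(x, z)`. -/
def normSqZ (n : ℕ) (κ : Type) [Fintype κ] : MvPolynomial (Fin n ⊕ κ) ℝ :=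
  ∑ s : κ, X (Sum.inr s) * X (Sum.inr s)

/-- The objective `zᵀ B(x) z`. -/
def quadForm (B : LinearPencil n κ) : MvPolynomial (Fin n ⊕ κ) ℝ :=
  ∑ s : κ, ∑ t : κ, X (Sum.inr s) * B.toPoly Sum.inl s t * X (Sum.inr t)

/-- The constraint `G_A(x, z) = diag(A(x), zᵀz - r², R² - zᵀz)`. -/
def constraintMatrix (κ : Type) [Fintype κ] (A : LinearPencil n ι) (r R : ℝ) :
    Matrix (ι ⊕ Fin 2) (ι ⊕ Fin 2) (MvPolynomial (Fin n ⊕ κ) ℝ) :=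
  Matrix.fromBlocks (A.toPoly Sum.inl) 0 0
    (Matrix.diagonal ![normSqZ n κ - C (r ^ 2), C (R ^ 2) - normSqZ n κ])

/-- The sequence `y` is feasible for the moment relaxation of order `t` (`t ≥ 2`); sequences are
normalized by `y₀ = 1`. -/
def MomentFeasible (κ : Type) [Fintype κ] (A : LinearPencil n ι) (r R : ℝ) (t : ℕ)
    (y : (Fin n ⊕ κ →₀ ℕ) → ℝ) : Prop :=
  y 0 = 1 ∧ (momentMatrix t y).PosSemidef ∧
    (localizingMatrix (t - 1) (constraintMatrix κ A r R) y).PosSemidef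

/-- The optimal value `μ_mom(t)` of the moment relaxation, the infimum of `L_y(zᵀ B(x) z)` over the
feasible sequences, in the extended reals. -/
def muMom (A : LinearPencil n ι) (B : LinearPencil n κ) (r R : ℝ) (t : ℕ) : EReal :=
  ⨅ (y : (Fin n ⊕ κ →₀ ℕ) → ℝ) (_ : MomentFeasible κ A r R t y), (linearize y (quadForm B) : EReal)

end Moments

end

/-! Every implication passes through one certificate. By `extend_sdfpSolvable_iff`, the SDFP for the
extended pencil is solvable exactly when `B(x) = D + ∑ A(x)_ij C_ij` with constant PSD matrices `C`
and `D`. An order-zero sos certificate has constant multipliers, and its residual is a pencil that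
is PSD on all of `ℝⁿ`, hence constant; so it is the same certificate for `B - lam I`
(`sosFeasible_zero_iff`). Sandwiching the identity between `zᵀ` and `z` and applying `L_y` leaves
`lam * L_y(zᵀz)` plus trace products of PSD matrices. Since `L_y(zᵀz)` lies in `[0, R²]`, values of
`lam` tending to zero suffice for the moment bound. Point evaluations are feasible moment sequences,
which gives the containment. The containment is equivalent to positivity by homogenizing: a PSD
element of the extended span is a multiple of a point of `S_A` or a recession direction.

The converses rest on closedness. If the span contains a positive definite matrix, the linear map of
the SDFP kills no nonzero PSD matrix, so the cone of solvable right-hand sides is closed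
(`isClosed_sdfpCone`). Limits then stay solvable. If `B` is unsolvable, a separating functional is a
PSD matrix `∑ Λ_p ⊗ A_p` (`exists_dual_matrices`) whose image under the map contradicts complete
positivity.

For bounded `S_A` and independent coefficients, `1 = ⟨W, A(x)⟩` with `W` PSD (`sdfpSolvable_one`),
so the slack `D` is absorbed as `W ⊗ D` and the extension becomes superfluous. -/

noncomputable section

/-! ### Positive semidefinite matrices through entrywise sums and Gram vectors. -/

section PosSemidef

variable {ι κ : Type*}

theorem sum_rotate {α β γ M : Type*} [Fintype α] [Fintype β] [Fintype γ] [AddCommMonoid M]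
    (f : α → β → γ → M) : ∑ a, ∑ b, ∑ c, f a b c = ∑ c, ∑ a, ∑ b, f a b c := by
  rw [Finset.sum_comm (γ := γ)]
  exact Finset.sum_congr rfl fun a _ => Finset.sum_comm

theorem posSemidef_iff_sum [Fintype ι] {M : Matrix ι ι ℝ} :
    M.PosSemidef ↔ (∀ i j, M i j = M j i) ∧ ∀ v : ι → ℝ, 0 ≤ ∑ i, ∑ j, M i j * (v i * v j) := by
  rw [Matrix.posSemidef_iff_dotProduct_mulVec]
  refine and_congr ⟨fun h i j => ?_, fun h => ?_⟩ (forall_congr' fun v => ?_)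
  · simpa using (h.apply i j).symm
  · ext i j
    simpa using h j i
  · simp only [dotProduct, Matrix.mulVec, Finset.mul_sum, star_trivial]
    have : ∀ i j, v i * (M i j * v j) = M i j * (v i * v j) := fun i j => by ring
    simp only [this]

theorem Matrix.PosSemidef.exists_gram [Finite ι] {M : Matrix ι ι ℝ} (hM : M.PosSemidef) :
    ∃ (m : ℕ) (V : ι → Fin m → ℝ), ∀ i j, M i j = ∑ c, V i c * V j c := by
  obtain ⟨m, v, rfl⟩ := Matrix.posSemidef_iff_eq_sum_vecMulVec.1 hM
  exact ⟨m, fun i c => v c i, fun i j => by simp [Matrix.sum_apply, Matrix.vecMulVec_apply]⟩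

theorem posSemidef_of_gram [Fintype ι] {γ : Type*} [Fintype γ] {M : Matrix ι ι ℝ}
    (V : ι → γ → ℝ) (h : ∀ i j, M i j = ∑ c, V i c * V j c) : M.PosSemidef := by
  refine posSemidef_iff_sum.2 ⟨fun i j => by simp only [h, mul_comm], fun v => ?_⟩
  have : ∑ i, ∑ j, M i j * (v i * v j) = ∑ c, (∑ i, V i c * v i) ^ 2 := by
    simp only [h, Finset.sum_mul, sq, Finset.mul_sum]
    rw [sum_rotate]
    exact Finset.sum_congr rfl fun c _ => by
      rw [Finset.sum_comm]
      exact Finset.sum_congr rfl fun i _ => Finset.sum_congr rfl fun j _ => by ring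
  rw [this]
  positivity

/-- A Gram factorization of `Q` turns the trace product into a sum of values of the quadratic form
of `P`. -/
theorem sum_mul_nonneg_of_posSemidef [Fintype ι] {P Q : Matrix ι ι ℝ} (hP : P.PosSemidef)
    (hQ : Q.PosSemidef) : 0 ≤ ∑ i, ∑ j, P i j * Q i j := by
  obtain ⟨m, V, hV⟩ := hQ.exists_gram
  have : ∑ i, ∑ j, P i j * Q i j = ∑ c, ∑ i, ∑ j, P i j * (V i c * V j c) := by
    simp only [hV, Finset.mul_sum]
    exact sum_rotate _
  rw [this]
  exact Finset.sum_nonneg fun c _ => (posSemidef_iff_sum.1 hP).2 fun i => V i c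

/-- Conjugating a positive semidefinite matrix, written with sums. -/
theorem Matrix.PosSemidef.conj_sum [Fintype ι] [Fintype κ] {M : Matrix ι ι ℝ} (hM : M.PosSemidef)
    (T : κ → ι → ℝ) {N : Matrix κ κ ℝ} (hN : ∀ s t, N s t = ∑ i, ∑ j, M i j * (T s i * T t j)) :
    N.PosSemidef := by
  obtain ⟨m, V, hV⟩ := hM.exists_gram
  refine posSemidef_of_gram (fun s c => ∑ i, T s i * V i c) fun s t => ?_
  simp only [hN, hV, Finset.sum_mul, Finset.mul_sum]
  rw [sum_rotate]
  refine Finset.sum_congr rfl fun c _ => ?_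
  rw [Finset.sum_comm]
  exact Finset.sum_congr rfl fun i _ => Finset.sum_congr rfl fun j _ => by ring

theorem Matrix.PosSemidef.mul_submatrix [Finite κ] {M : Matrix ι ι ℝ} (hM : M.PosSemidef)
    (e : κ → ι) (u : κ → ℝ) : (Matrix.of fun a b => u a * M (e a) (e b) * u b).PosSemidef := by
  have := Fintype.ofFinite κ
  obtain ⟨hs, hv⟩ := posSemidef_iff_sum.1 (hM.submatrix e)
  refine posSemidef_iff_sum.2 ⟨fun a b => ?_, fun v => ?_⟩
  · have := hs a b
    simp only [Matrix.submatrix_apply, Matrix.of_apply] at this ⊢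
    rw [this]; ring
  · refine (hv fun a => u a * v a).trans_eq ?_
    refine Finset.sum_congr rfl fun i _ => Finset.sum_congr rfl fun j _ => ?_
    simp only [Matrix.submatrix_apply, Matrix.of_apply]
    ring

theorem eq_zero_of_posSemidef_neg [Finite ι] {M : Matrix ι ι ℝ} (hM : M.PosSemidef)
    (hM' : (-M).PosSemidef) : M = 0 := by
  obtain ⟨m, V, hV⟩ := hM.exists_gram
  have h0 : ∀ i c, V i c = 0 := by
    intro i c
    have h1 : ∑ c, V i c * V i c ≤ 0 := by
      rw [← hV]
      simpa using hM'.diag_nonneg (i := i)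
    have h2 := (Finset.sum_eq_zero_iff_of_nonneg fun c _ => mul_self_nonneg (V i c)).1
      (h1.antisymm (Finset.sum_nonneg fun c _ => mul_self_nonneg (V i c)))
    exact mul_self_eq_zero.1 (h2 c (Finset.mem_univ c))
  ext i j
  simp [hV, h0]

theorem isClosed_posSemidef [Finite ι] :
    IsClosed {M : ι → ι → ℝ | (Matrix.of M).PosSemidef} := by
  have := Fintype.ofFinite ι
  simp only [posSemidef_iff_sum, Matrix.of_apply, Set.ofPred_and, Set.ofPred_forall]
  refine IsClosed.inter (isClosed_iInter fun i => isClosed_iInter fun j => ?_)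
    (isClosed_iInter fun v => ?_)
  · exact isClosed_eq (by fun_prop) (by fun_prop)
  · exact isClosed_le (by fun_prop) (by fun_prop)

/-- The cone of positive semidefinite matrices. -/
def psdCone (ι : Type*) : PointedCone ℝ (ι → ι → ℝ) where
  carrier := {M | (Matrix.of M).PosSemidef}
  add_mem' hM hN := Matrix.PosSemidef.add hM hN
  zero_mem' := Matrix.PosSemidef.zero
  smul_mem' c _ hM := Matrix.PosSemidef.smul hM c.2

end PosSemidef

/-! ### Closed images of cones, and separation from a cone that need not be closed. -/

section Cone

open Filter Topology

variable {E F : Type*} [NormedAddCommGroup E] [NormedSpace ℝ E] [FiniteDimensional ℝ E]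
  [NormedAddCommGroup F] [NormedSpace ℝ F]

/-- The image of a closed cone under a linear map whose kernel meets the cone trivially is
closed. -/
theorem isClosed_image_of_ker_trivial (L : E →ₗ[ℝ] F) {P : Set E} (hP : IsClosed P)
    (hsmul : ∀ c : ℝ, 0 ≤ c → ∀ x ∈ P, c • x ∈ P) (hker : ∀ x ∈ P, L x = 0 → x = 0) :
    IsClosed (L '' P) := by
  have hL : Continuous L := L.continuous_of_finiteDimensional
  have := FiniteDimensional.proper ℝ E
  -- `δ` is the minimum of `‖L x‖` over the unit vectors of `P`, positive by the kernel condition;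
  -- homogeneity extends the bound to all of `P`.
  obtain ⟨δ, hδ, hbound⟩ : ∃ δ > 0, ∀ x ∈ P, δ * ‖x‖ ≤ ‖L x‖ := by
    have hK : IsCompact (Metric.sphere (0 : E) 1 ∩ P) := (isCompact_sphere 0 1).inter_right hP
    rcases (Metric.sphere (0 : E) 1 ∩ P).eq_empty_or_nonempty with he | hne
    · refine ⟨1, one_pos, fun x hx => ?_⟩
      by_cases h0 : x = 0
      · simp [h0]
      · have : ‖x‖⁻¹ • x ∈ Metric.sphere (0 : E) 1 ∩ P :=
          ⟨by simp [norm_smul, h0], hsmul _ (by positivity) x hx⟩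
        simp [he] at this
    · obtain ⟨x₀, hx₀, hmin⟩ := hK.exists_isMinOn hne hL.norm.continuousOn
      have hx₀n : ‖x₀‖ = 1 := by simpa using hx₀.1
      refine ⟨‖L x₀‖, norm_pos_iff.2 fun h => ?_, fun x hx => ?_⟩
      · rw [hker x₀ hx₀.2 h, norm_zero] at hx₀n
        exact zero_ne_one hx₀n
      · by_cases h0 : x = 0
        · simp [h0]
        · have h1 := hmin (⟨by simp [norm_smul, h0], hsmul _ (by positivity) x hx⟩ :
            ‖x‖⁻¹ • x ∈ Metric.sphere (0 : E) 1 ∩ P)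
          have hpos : 0 < ‖x‖ := norm_pos_iff.2 h0
          simp only [Set.mem_ofPred_eq, map_smul, norm_smul, norm_inv, norm_norm] at h1
          rwa [inv_mul_eq_div, le_div_iff₀ hpos] at h1
  refine IsSeqClosed.isClosed fun y b hy hb => ?_
  choose x hxP hxy using hy
  obtain ⟨M, hM⟩ := hb.norm.bddAbove_range
  have hxb : ∀ k, x k ∈ Metric.closedBall (0 : E) (M / δ) := fun k => by
    rw [mem_closedBall_zero_iff, le_div_iff₀ hδ, mul_comm]
    exact (hbound _ (hxP k)).trans (hxy k ▸ hM ⟨k, rfl⟩)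
  obtain ⟨a, -, φ, hφ, ha⟩ := tendsto_subseq_of_bounded Metric.isBounded_closedBall hxb
  refine ⟨a, hP.mem_of_tendsto ha (Eventually.of_forall fun k => hxP _), ?_⟩
  refine tendsto_nhds_unique ((hL.tendsto a).comp ha) ?_
  simpa [Function.comp_def, hxy] using hb.comp hφ.tendsto_atTop

/-- A point outside a convex cone in a finite-dimensional space can be weakly separated from it by
a nonzero functional, whether or not the cone is closed. -/
theorem PointedCone.exists_ne_zero_of_notMem (K : PointedCone ℝ E) {e : E} (he : e ∉ K) :
    ∃ f : E →ₗ[ℝ] ℝ, f ≠ 0 ∧ f e ≤ 0 ∧ ∀ w ∈ K, 0 ≤ f w := by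
  have hconv : Convex ℝ (K : Set E) := K.convex
  by_cases hint : (interior (K : Set E)).Nonempty
  · obtain ⟨f, hf, hfe⟩ := geometric_hahn_banach_of_nonempty_interior_point hconv
      (fun h => he (interior_subset h)) hint
    have h0 : 0 ≤ f e := by simpa using hfe 0 K.zero_mem
    refine ⟨-(f : E →ₗ[ℝ] ℝ), fun h => hf ?_, by simpa using h0, fun w hw => ?_⟩
    · ext x
      simpa using congrArg (fun g : E →ₗ[ℝ] ℝ => g x) h
    · simp only [LinearMap.neg_apply, ContinuousLinearMap.coe_coe, Left.nonneg_neg_iff]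
      by_contra! hpos
      -- A positive value at `w` could be scaled to `f e + 1`, above the upper bound `f e` on the
      -- cone.
      have h1 := hfe (((f e + 1) / f w) • w) (PointedCone.smul_mem K (by positivity) hw)
      rw [map_smul, smul_eq_mul, div_mul_cancel₀ _ hpos.ne'] at h1
      linarith
  -- A convex cone with empty interior spans a proper subspace; a functional vanishing on it
  -- separates after a choice of sign.
  · have hspan : Submodule.span ℝ (K : Set E) < ⊤ := by
      rw [lt_top_iff_ne_top]
      intro h
      rw [hconv.interior_nonempty_iff_affineSpan_eq_top] at hint
      apply hint
      have h0 : (0 : E) ∈ (K : Set E) := K.zero_mem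
      rw [AffineSubspace.affineSpan_eq_top_iff_vectorSpan_eq_top_of_nonempty ℝ E E ⟨0, h0⟩,
        vectorSpan_eq_span_vsub_set_right ℝ h0]
      simpa using h
    obtain ⟨f, hf, hle⟩ := Submodule.exists_le_ker_of_lt_top _ hspan
    have hz : ∀ w ∈ K, f w = 0 := fun w hw => hle (Submodule.subset_span hw)
    rcases le_total (f e) 0 with h | h
    · exact ⟨f, hf, h, fun w hw => (hz w hw).ge⟩
    · exact ⟨-f, neg_ne_zero.2 hf, by simpa using h, fun w hw => by simp [hz w hw]⟩

end Cone

/-! ### The cone of solvable right-hand sides of the SDFP and its dual. -/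

namespace LinearPencil

variable {n : ℕ} {ι κ : Type}

section Sdfp

variable [Fintype ι] [Fintype κ]

/-- The linear map `C ↦ (∑_{i,j} (A_p)_ij C_ij)_p` of the semidefinite feasibility problem. -/
def sdfpMap (A : LinearPencil n ι) (κ : Type) :
    (ι × κ → ι × κ → ℝ) →ₗ[ℝ] (Fin (n + 1) → κ → κ → ℝ) where
  toFun C p s t := ∑ i, ∑ j, A.coeff p i j * C (i, s) (j, t)
  map_add' C D := by
    ext p s t
    simp [mul_add, Finset.sum_add_distrib]
  map_smul' c C := by
    ext p s t
    simp [Finset.mul_sum, mul_left_comm]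

omit [Fintype κ] in
theorem sdfpMap_apply (A : LinearPencil n ι) (C : ι × κ → ι × κ → ℝ) (p : Fin (n + 1)) (s t : κ) :
    A.sdfpMap κ C p s t = ∑ i, ∑ j, A.coeff p i j * C (i, s) (j, t) := rfl

/-- The cone of all right-hand sides for which the semidefinite feasibility problem is solvable. -/
def sdfpCone (A : LinearPencil n ι) (κ : Type) [Fintype κ] :
    PointedCone ℝ (Fin (n + 1) → κ → κ → ℝ) :=
  (psdCone (ι × κ)).map (A.sdfpMap κ)

theorem sdfpSolvable_iff (A : LinearPencil n ι) (B : LinearPencil n κ) :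
    A.SDFPSolvable B ↔ (fun p s t => B.coeff p s t) ∈ A.sdfpCone κ := by
  constructor
  · rintro ⟨C, hC, h⟩
    refine ⟨Matrix.comp ι ι κ κ ℝ C, hC, ?_⟩
    ext p s t
    simp only [h p, Matrix.sum_apply]
    rfl
  · rintro ⟨C, hC, h⟩
    refine ⟨(Matrix.comp ι ι κ κ ℝ).symm (Matrix.of C), hC, fun p => ?_⟩
    ext s t
    rw [← show _ = B.coeff p s t from congrFun (congrFun (congrFun h p) s) t]
    simp [sdfpMap_apply, Matrix.sum_apply]

/-- By linearity `∑ X_ij C_ij = 0` for the positive definite `X` in the span. Its diagonal entries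
are sums of values of the form of `X` at Gram vectors of `C`, so definiteness makes these vectors
zero. -/
theorem eq_zero_of_sdfpMap_eq_zero {A : LinearPencil n ι} (hA : ContainsPosDef A.coeffSpan)
    {C : ι × κ → ι × κ → ℝ} (hC : (Matrix.of C).PosSemidef) (h : A.sdfpMap κ C = 0) : C = 0 := by
  obtain ⟨X, hX, hpos⟩ := hA
  have hspan : ∀ s t, ∑ i, ∑ j, X i j * C (i, s) (j, t) = 0 := by
    intro s t
    clear hpos
    induction hX using Submodule.span_induction with
    | mem x hx =>
      obtain ⟨p, rfl⟩ := hx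
      exact congrFun (congrFun (congrFun h p) s) t
    | zero => simp
    | add x y _ _ hx hy => simp [add_mul, Finset.sum_add_distrib, hx, hy]
    | smul c x _ hx => simp [mul_assoc, ← Finset.mul_sum, hx]
  obtain ⟨m, V, hV⟩ := hC.exists_gram
  simp only [Matrix.of_apply] at hV
  have hVz : ∀ s c, (fun i => V (i, s) c) = 0 := by
    intro s c
    have h0 : ∑ c, ∑ i, ∑ j, X i j * (V (i, s) c * V (j, s) c) = 0 := by
      rw [← hspan s s, ← sum_rotate]
      simp only [hV, Finset.mul_sum]
    rw [Finset.sum_eq_zero_iff_of_nonneg fun c _ =>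
      (posSemidef_iff_sum.1 hpos.posSemidef).2 fun i => V (i, s) c] at h0
    by_contra hne
    have h1 := hpos.dotProduct_mulVec_pos hne
    refine h1.ne' ((Eq.trans ?_ (h0 c (Finset.mem_univ c))))
    simp only [dotProduct, Matrix.mulVec, Finset.mul_sum, star_trivial]
    exact Finset.sum_congr rfl fun i _ => Finset.sum_congr rfl fun j _ => by ring
  ext ⟨i, s⟩ ⟨j, t⟩
  rw [hV]
  exact Finset.sum_eq_zero fun c _ => by
    rw [show V (i, s) c = 0 from congrFun (hVz s c) i, zero_mul]

theorem isClosed_sdfpCone {A : LinearPencil n ι} (hA : ContainsPosDef A.coeffSpan) (κ : Type)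
    [Fintype κ] : IsClosed (A.sdfpCone κ : Set (Fin (n + 1) → κ → κ → ℝ)) := by
  have : (A.sdfpCone κ : Set (Fin (n + 1) → κ → κ → ℝ)) =
      A.sdfpMap κ '' {M | (Matrix.of M).PosSemidef} := by
    ext; rfl
  rw [this]
  exact isClosed_image_of_ker_trivial _ isClosed_posSemidef (fun c hc x hx => hx.smul hc)
    fun x hx h => eq_zero_of_sdfpMap_eq_zero hA hx h

/-- A functional that is nonnegative on the cone of the semidefinite feasibility problem is given
by symmetric matrices `Λ_p` for which `∑_p Λ_p ⊗ A_p` is positive semidefinite. -/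
theorem exists_dual_matrices (A : LinearPencil n ι) (f : (Fin (n + 1) → κ → κ → ℝ) →ₗ[ℝ] ℝ)
    (hf : ∀ w ∈ A.sdfpCone κ, 0 ≤ f w) :
    ∃ Λ : Fin (n + 1) → κ → κ → ℝ, (∀ p s t, Λ p s t = Λ p t s) ∧
      (∀ b : Fin (n + 1) → κ → κ → ℝ, (∀ p s t, b p s t = b p t s) →
        f b = ∑ p, ∑ s, ∑ t, Λ p s t * b p s t) ∧
      (Matrix.of fun x y : κ × ι => ∑ p, Λ p x.1 y.1 * A.coeff p x.2 y.2).PosSemidef := by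
  classical
  let F : Fin (n + 1) → κ → κ → ℝ := fun p s t =>
    f (Pi.single p (Pi.single s (Pi.single t 1)))
  have hF : ∀ b, f b = ∑ p, ∑ s, ∑ t, F p s t * b p s t := by
    intro b
    have hb : b = ∑ p, ∑ s, ∑ t, b p s t • (Pi.single p (Pi.single s (Pi.single t 1)) :
        Fin (n + 1) → κ → κ → ℝ) := by
      ext p s t
      simp [Finset.sum_apply, Pi.single_apply, apply_ite, ite_apply]
    conv_lhs => rw [hb]
    simp [F, mul_comm]
  -- The matrices `F p` need not be symmetric, but replacing them by their symmetric parts does not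
  -- change `f` on symmetric arguments.
  have hsymm : ∀ b : Fin (n + 1) → κ → κ → ℝ, (∀ p s t, b p s t = b p t s) →
      f b = ∑ p, ∑ s, ∑ t, (F p s t + F p t s) / 2 * b p s t := by
    intro b hb
    have h1 : ∑ p, ∑ s, ∑ t, F p t s * b p s t = f b := by
      rw [hF]
      refine Finset.sum_congr rfl fun p _ => ?_
      rw [Finset.sum_comm]
      exact Finset.sum_congr rfl fun s _ => Finset.sum_congr rfl fun t _ => by rw [hb p t s]
    have h2 : ∑ p, ∑ s, ∑ t, (F p s t + F p t s) / 2 * b p s t =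
        (f b + ∑ p, ∑ s, ∑ t, F p t s * b p s t) / 2 := by
      rw [hF b]
      simp only [← Finset.sum_add_distrib, Finset.sum_div]
      refine Finset.sum_congr rfl fun p _ => Finset.sum_congr rfl fun s _ =>
        Finset.sum_congr rfl fun t _ => by ring
    rw [h2, h1]
    ring
  refine ⟨fun p s t => (F p s t + F p t s) / 2, fun p s t => by ring, hsymm, ?_⟩
  refine posSemidef_iff_sum.2 ⟨fun x y => ?_, fun v => ?_⟩
  · simp only [Matrix.of_apply]
    refine Finset.sum_congr rfl fun p _ => ?_
    rw [(A.symm p).apply x.2 y.2]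
    ring
  -- On the rank-one matrix `C = v vᵀ`, with tensor factors swapped, `f` evaluates the quadratic
  -- form of `∑ Λ_p ⊗ A_p` at `v`.
  · have hC : (Matrix.of fun x y : ι × κ => v x.swap * v y.swap).PosSemidef :=
      posSemidef_of_gram (γ := Unit) (fun x _ => v x.swap) fun x y => by simp
    have hw := hf _ ⟨_, hC, rfl⟩
    refine hw.trans_eq ?_
    change f (A.sdfpMap κ fun x y : ι × κ => v x.swap * v y.swap) = _
    rw [hsymm]
    · simp only [sdfpMap_apply, Matrix.of_apply, Prod.swap, Finset.sum_mul, Finset.mul_sum]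
      conv_rhs => rw [sum_rotate]
      refine Finset.sum_congr rfl fun p _ => ?_
      simp only [Fintype.sum_prod_type]
      refine Finset.sum_congr rfl fun s _ => ?_
      rw [Finset.sum_comm (γ := ι)]
      exact Finset.sum_congr rfl fun t _ => Finset.sum_congr rfl fun i _ =>
        Finset.sum_congr rfl fun j _ => by ring
    · intro p s t
      simp only [sdfpMap_apply]
      rw [Finset.sum_comm]
      refine Finset.sum_congr rfl fun i _ => Finset.sum_congr rfl fun j _ => ?_
      rw [(A.symm p).apply]
      simp only [Prod.swap]
      ring

end Sdfp

/-! ### Positivity and complete positivity of the map `A_p ↦ B_p`. -/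

section CoeffMap

theorem coeffMap_eq_sum (A : LinearPencil n ι) (B : LinearPencil n κ)
    (hA : LinearIndependent ℝ A.coeff) (X : A.coeffSpan) (c : Fin (n + 1) → ℝ)
    (hX : (X : Matrix ι ι ℝ) = ∑ p, c p • A.coeff p) :
    (A.coeffMap B hA X : Matrix κ κ ℝ) = ∑ p, c p • B.coeff p := by
  have : X = ∑ p, c p • (⟨A.coeff p, Submodule.subset_span ⟨p, rfl⟩⟩ : A.coeffSpan) := by
    ext1
    simp [hX]
  rw [this, map_sum]
  simp only [map_smul, Submodule.coe_sum, Submodule.coe_smul, coeffMap_coeff]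

theorem isPositiveMap_coeffMap_iff (A : LinearPencil n ι) (B : LinearPencil n κ)
    (hA : LinearIndependent ℝ A.coeff) :
    IsPositiveMap (A.coeffMap B hA) ↔
      ∀ c : Fin (n + 1) → ℝ, (∑ p, c p • A.coeff p).PosSemidef →
        (∑ p, c p • B.coeff p).PosSemidef := by
  constructor
  · intro h c hc
    have hmem : ∑ p, c p • A.coeff p ∈ A.coeffSpan :=
      Submodule.sum_mem _ fun p _ => Submodule.smul_mem _ _ (Submodule.subset_span ⟨p, rfl⟩)
    have := h ⟨_, hmem⟩ hc
    rwa [A.coeffMap_eq_sum B hA _ c rfl] at this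
  · intro h X hX
    obtain ⟨c, hc⟩ := (Submodule.mem_span_range_iff_exists_fun ℝ).1 X.2
    rw [A.coeffMap_eq_sum B hA X c hc.symm]
    exact h c (hc ▸ hX)

variable [Fintype ι] [Fintype κ]

/-- A solution `C` acts as a Choi matrix: `Φ(X) = ∑ X_ij C_ij`. Its Gram factorization writes `Φ` as
a sum of conjugations `V_cᵀ X V_c`, each completely positive. -/
theorem SDFPSolvable.isCompletelyPositiveMap {A : LinearPencil n ι} {B : LinearPencil n κ}
    (h : A.SDFPSolvable B) (hA : LinearIndependent ℝ A.coeff) :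
    IsCompletelyPositiveMap (A.coeffMap B hA) := by
  obtain ⟨C, hC, hB⟩ := h
  have hΦ : ∀ (X : A.coeffSpan) (s t : κ), (A.coeffMap B hA X : Matrix κ κ ℝ) s t =
      ∑ i, ∑ j, (X : Matrix ι ι ℝ) i j * C i j s t := by
    intro X s t
    obtain ⟨c, hc⟩ := (Submodule.mem_span_range_iff_exists_fun ℝ).1 X.2
    rw [A.coeffMap_eq_sum B hA X c hc.symm, ← hc]
    simp only [Matrix.sum_apply, Matrix.smul_apply, hB, smul_eq_mul, Finset.mul_sum,
      Finset.sum_mul, mul_assoc]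
    rw [← sum_rotate]
  intro d _ X hX
  obtain ⟨m, V, hV⟩ := hC.exists_gram
  have hV' : ∀ i j s t, C i j s t = ∑ c, V (i, s) c * V (j, t) c := fun i j s t =>
    hV (i, s) (j, t)
  have hsum : Matrix.comp (Fin d) (Fin d) κ κ ℝ
      (Matrix.of fun a b => (A.coeffMap B hA (X a b) : Matrix κ κ ℝ)) =
      ∑ c, Matrix.of fun x y : Fin d × κ => ∑ i, ∑ j,
        (X x.1 y.1 : Matrix ι ι ℝ) i j * (V (i, x.2) c * V (j, y.2) c) := by
    ext x y
    simp only [Matrix.comp_apply, Matrix.of_apply, hΦ, hV', Matrix.sum_apply, Finset.mul_sum]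
    rw [sum_rotate]
  rw [hsum]
  refine Matrix.posSemidef_sum _ fun c _ => ?_
  -- Conjugation by the block-diagonal matrix with `d` copies of `V_c`.
  refine hX.conj_sum (fun x y => if x.1 = y.1 then V (y.2, x.2) c else 0) fun x y => ?_
  simp [Fintype.sum_prod_type, Matrix.comp_apply]

/-- If `B` lay outside the closed cone, a functional would be nonnegative on the cone and negative
at `B`. Its dual matrices form a PSD block matrix `∑ Λ_p ⊗ A_p` with `l × l` blocks in the span, so
`l`-positivity alone already gives the contradiction. -/
theorem sdfpSolvable_of_isCompletelyPositiveMap {l : ℕ} {A : LinearPencil n ι}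
    {B : LinearPencil n (Fin l)} {hA : LinearIndependent ℝ A.coeff}
    (hpos : ContainsPosDef A.coeffSpan) (h : IsCompletelyPositiveMap (A.coeffMap B hA)) :
    A.SDFPSolvable B := by
  rw [sdfpSolvable_iff]
  by_contra hB
  obtain ⟨f, hf, hfB⟩ := ProperCone.hyperplane_separation_point
    (⟨A.sdfpCone (Fin l), isClosed_sdfpCone hpos _⟩ : ProperCone ℝ _) hB
  obtain ⟨Λ, hΛ, hfΛ, hpsd⟩ := A.exists_dual_matrices (κ := Fin l) (f : _ →ₗ[ℝ] ℝ) hf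
  have hfB' := hfΛ (fun p s t => B.coeff p s t) fun p s t => ((B.symm p).apply t s)
  rw [ContinuousLinearMap.coe_coe] at hfB'
  rw [hfB'] at hfB
  rcases Nat.eq_zero_or_pos l with rfl | hl
  -- For `l = 0` there is no positive `d = l` to use, but the pairing is then an empty sum, which is
  -- not negative.
  · simp at hfB
  have hmem : ∀ s t, ∑ p, Λ p s t • A.coeff p ∈ A.coeffSpan := fun s t =>
    Submodule.sum_mem _ fun p _ => Submodule.smul_mem _ _ (Submodule.subset_span ⟨p, rfl⟩)
  have hcp := h l hl (fun s t => ⟨_, hmem s t⟩) (by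
    convert hpsd using 1
    ext x y
    simp [Matrix.comp_apply, Matrix.sum_apply])
  have hΦ : ∀ s t, (A.coeffMap B hA ⟨_, hmem s t⟩ : Matrix (Fin l) (Fin l) ℝ) =
      ∑ p, Λ p s t • B.coeff p := fun s t => A.coeffMap_eq_sum B hA _ _ rfl
  simp only [hΦ] at hcp
  -- At the vector `∑ e_s ⊗ e_s` the quadratic form of the image equals the value of the functional
  -- at `B`.
  have h0 := (posSemidef_iff_sum.1 hcp).2 fun x => if x.1 = x.2 then 1 else 0
  simp [Fintype.sum_prod_type, Matrix.comp_apply, Matrix.sum_apply] at h0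
  rw [sum_rotate] at h0
  exact absurd h0 hfB.not_ge

end CoeffMap

end LinearPencil

/-! ### Homogenization of spectrahedra and their recession directions. -/

namespace LinearPencil

variable {n : ℕ} {ι κ : Type}

theorem sum_cons_smul (A : LinearPencil n ι) (c : ℝ) (x : Fin n → ℝ) :
    ∑ p, (Fin.cons c x : Fin (n + 1) → ℝ) p • A.coeff p =
      c • A.coeff 0 + ∑ p : Fin n, x p • A.coeff p.succ := by
  simp [Fin.sum_univ_succ]

theorem eval_eq_sum (A : LinearPencil n ι) (x : Fin n → ℝ) :
    A.eval x = ∑ p, (Fin.cons 1 x : Fin (n + 1) → ℝ) p • A.coeff p := by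
  rw [sum_cons_smul, one_smul, eval]

theorem sum_smul_eq (A : LinearPencil n ι) (c : Fin (n + 1) → ℝ) (h : c 0 ≠ 0) :
    ∑ p, c p • A.coeff p = c 0 • A.eval fun p => c p.succ / c 0 := by
  rw [Fin.sum_univ_succ, eval, smul_add, Finset.smul_sum]
  congr 1
  exact Finset.sum_congr rfl fun p _ => by rw [smul_smul, mul_div_cancel₀ _ h]

theorem eval_add_smul (A : LinearPencil n ι) (x y : Fin n → ℝ) (t : ℝ) :
    A.eval (x + t • y) = A.eval x + t • ∑ p : Fin n, y p • A.coeff p.succ := by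
  simp [eval, add_smul, Finset.sum_add_distrib, Finset.smul_sum, smul_smul, add_assoc]

theorem isSymm_sum_smul (A : LinearPencil n ι) {γ : Type*} [Fintype γ] (e : γ → Fin (n + 1))
    (c : γ → ℝ) : (∑ p, c p • A.coeff (e p)).IsSymm := by
  ext i j
  simp only [Matrix.transpose_apply, Matrix.sum_apply, Matrix.smul_apply, (A.symm _).apply j i]

/-- The recession directions of a spectrahedron are the solutions of the homogeneous matrix
inequality. -/
theorem posSemidef_of_add_smul_mem [Fintype κ] (B : LinearPencil n κ) {x y : Fin n → ℝ}
    (h : ∀ t : ℝ, 0 ≤ t → x + t • y ∈ B.spectrahedron) :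
    (∑ p : Fin n, y p • B.coeff p.succ).PosSemidef := by
  refine posSemidef_iff_sum.2 ⟨fun i j => (B.isSymm_sum_smul Fin.succ y).apply j i, fun v => ?_⟩
  have hq : ∀ t : ℝ, 0 ≤ t → 0 ≤ (∑ i, ∑ j, B.eval x i j * (v i * v j)) +
      t * ∑ i, ∑ j, (∑ p : Fin n, y p • B.coeff p.succ) i j * (v i * v j) := by
    intro t ht
    have h1 := (posSemidef_iff_sum.1 (show (B.eval (x + t • y)).PosSemidef from h t ht)).2 v
    rw [eval_add_smul] at h1
    refine h1.trans_eq ?_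
    simp only [Finset.mul_sum, ← Finset.sum_add_distrib]
    exact Finset.sum_congr rfl fun i _ => Finset.sum_congr rfl fun j _ => by
      simp only [Matrix.add_apply, Matrix.smul_apply, smul_eq_mul]; ring
  generalize (∑ i, ∑ j, B.eval x i j * (v i * v j)) = a at hq
  generalize (∑ i, ∑ j, (∑ p : Fin n, y p • B.coeff p.succ) i j * (v i * v j)) = b at hq ⊢
  by_contra! hb
  have ha : 0 ≤ a := by simpa using hq 0 le_rfl
  -- This parameter makes `a + t * b` equal to `-1`.
  have := hq ((a + 1) / -b) (div_nonneg (by linarith) (by linarith))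
  have hb' : (a + 1) / -b * b = -(a + 1) := by
    rw [div_neg, neg_mul, div_mul_cancel₀ _ hb.ne]
  linarith

theorem add_smul_mem_spectrahedron {A : LinearPencil n ι} {x y : Fin n → ℝ}
    (hx : x ∈ A.spectrahedron) (hy : (∑ p : Fin n, y p • A.coeff p.succ).PosSemidef) {t : ℝ}
    (ht : 0 ≤ t) : x + t • y ∈ A.spectrahedron := by
  change (A.eval (x + t • y)).PosSemidef
  rw [eval_add_smul]
  exact Matrix.PosSemidef.add hx (hy.smul ht)

/-- For `c 0 > 0` the combination is a positive multiple of `A` at a point of `S_A`. For `c 0 = 0`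
it is a recession direction, and a ray in `S_A` from an existing point stays in `S_B`. -/
theorem posSemidef_sum_of_subset [Fintype κ] {A : LinearPencil n ι} {B : LinearPencil n κ}
    (hne : A.spectrahedron.Nonempty) (h : A.spectrahedron ⊆ B.spectrahedron)
    {c : Fin (n + 1) → ℝ} (hc0 : 0 ≤ c 0) (hc : (∑ p, c p • A.coeff p).PosSemidef) :
    (∑ p, c p • B.coeff p).PosSemidef := by
  rcases hc0.eq_or_lt with h0 | h0
  · rw [Fin.sum_univ_succ, ← h0, zero_smul, zero_add] at hc ⊢
    obtain ⟨x, hx⟩ := hne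
    exact B.posSemidef_of_add_smul_mem fun t ht => h (add_smul_mem_spectrahedron hx hc ht)
  · rw [sum_smul_eq _ _ h0.ne'] at hc ⊢
    refine Matrix.PosSemidef.smul (h ?_) h0.le
    have := hc.smul (inv_nonneg.2 h0.le)
    rwa [smul_smul, inv_mul_cancel₀ h0.ne', one_smul] at this

theorem subset_of_posSemidef_sum {A : LinearPencil n ι} {B : LinearPencil n κ}
    (h : ∀ c : Fin (n + 1) → ℝ, 0 ≤ c 0 → (∑ p, c p • A.coeff p).PosSemidef →
        (∑ p, c p • B.coeff p).PosSemidef) : A.spectrahedron ⊆ B.spectrahedron := by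
  intro x hx
  change (B.eval x).PosSemidef
  rw [eval_eq_sum]
  refine h _ (by simp) ?_
  rw [← eval_eq_sum]
  exact hx

/-! ### The extended pencil. -/

section Extend

theorem sum_smul_extend (A : LinearPencil n ι) (c : Fin (n + 1) → ℝ) :
    ∑ p, c p • A.extend.coeff p =
      Matrix.fromBlocks (c 0 • 1) 0 0 (∑ p, c p • A.coeff p) := by
  ext (i | i) (j | j)
  · simp [extend, Matrix.sum_apply, Fin.sum_univ_succ, Fin.succ_ne_zero]
  all_goals simp [extend, Matrix.sum_apply]

theorem posSemidef_fromBlocks_unit [Finite ι] {c : ℝ} {M : Matrix ι ι ℝ} :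
    (Matrix.fromBlocks (c • (1 : Matrix Unit Unit ℝ)) 0 0 M).PosSemidef ↔
      0 ≤ c ∧ M.PosSemidef := by
  have := Fintype.ofFinite ι
  constructor
  · intro h
    exact ⟨by simpa using h.diag_nonneg (i := Sum.inl ()), h.submatrix Sum.inr⟩
  · rintro ⟨hc, hM⟩
    obtain ⟨hs, hv⟩ := posSemidef_iff_sum.1 hM
    refine posSemidef_iff_sum.2 ⟨?_, fun v => ?_⟩
    · rintro (i | i) (j | j)
      · rfl
      · rfl
      · rfl
      · exact hs i j
    · simpa using add_nonneg (mul_nonneg hc (mul_self_nonneg (v (Sum.inl ()))))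
        (hv fun i => v (Sum.inr i))

variable [Fintype ι] [Fintype κ]

/-- The additional `1 × 1` block contributes exactly the condition `0 ≤ c 0` of the homogenized
containment. -/
theorem subset_iff_isPositiveMap_extendedMap {A : LinearPencil n ι} (B : LinearPencil n κ)
    (hne : A.spectrahedron.Nonempty) (hA : LinearIndependent ℝ fun p : Fin n => A.coeff p.succ) :
    A.spectrahedron ⊆ B.spectrahedron ↔ IsPositiveMap (A.extendedMap B hA) := by
  rw [extendedMap, isPositiveMap_coeffMap_iff]
  simp only [sum_smul_extend, posSemidef_fromBlocks_unit]
  exact ⟨fun h c hc => posSemidef_sum_of_subset hne h hc.1 hc.2,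
    fun h => subset_of_posSemidef_sum fun c h0 hc => h c ⟨h0, hc⟩⟩

/-- The corner block of a solution enters only the equation for `p = 0`, as a PSD slack; the blocks
coupling it to the rest enter no equation and can be set to zero. -/
theorem extend_sdfpSolvable_iff (A : LinearPencil n ι) (B : LinearPencil n κ) :
    A.extend.SDFPSolvable B ↔ ∃ C : Matrix ι ι (Matrix κ κ ℝ),
      (Matrix.comp ι ι κ κ ℝ C).PosSemidef ∧
      (∀ p : Fin n, B.coeff p.succ = ∑ i, ∑ j, A.coeff p.succ i j • C i j) ∧
      (B.coeff 0 - ∑ i, ∑ j, A.coeff 0 i j • C i j).PosSemidef := by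
  constructor
  · rintro ⟨C, hC, h⟩
    refine ⟨Matrix.of fun i j => C (Sum.inr i) (Sum.inr j),
      hC.submatrix fun x : ι × κ => (Sum.inr x.1, x.2), fun p => ?_, ?_⟩
    · simpa [extend, Fin.succ_ne_zero] using h p.succ
    · have h0 := h 0
      simp only [extend, Fintype.sum_sum_type, Matrix.fromBlocks_apply₁₁,
        Matrix.fromBlocks_apply₁₂, Matrix.fromBlocks_apply₂₁, Matrix.fromBlocks_apply₂₂] at h0
      simp only [Finset.univ_unique, Finset.sum_singleton, if_true, Matrix.one_apply_eq, one_smul,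
        Matrix.zero_apply, zero_smul, Finset.sum_const_zero, add_zero, zero_add] at h0
      rw [h0]
      simp only [Matrix.of_apply, add_sub_cancel_right]
      exact hC.submatrix fun s : κ => (Sum.inl (), s)
  · rintro ⟨C, hC, h, h0⟩
    refine ⟨Matrix.fromBlocks (Matrix.of fun _ _ => B.coeff 0 - ∑ i, ∑ j, A.coeff 0 i j • C i j)
      0 0 C, ?_, fun p => ?_⟩
    · obtain ⟨hs, hv⟩ := posSemidef_iff_sum.1 hC
      obtain ⟨hs0, hv0⟩ := posSemidef_iff_sum.1 h0
      refine posSemidef_iff_sum.2 ⟨?_, fun v => ?_⟩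
      · rintro ⟨i | i, s⟩ ⟨j | j, t⟩
        · exact hs0 s t
        · rfl
        · rfl
        · exact hs (i, s) (j, t)
      · refine (add_nonneg (hv0 fun s => v (Sum.inl (), s))
          (hv fun x => v (Sum.inr x.1, x.2))).trans_eq ?_
        simp [Fintype.sum_prod_type, Matrix.comp_apply]
    · refine Fin.cases ?_ (fun p => ?_) p
      · simp [extend]
      · simp [extend, Fin.succ_ne_zero, h p]

theorem SDFPSolvable.extend {A : LinearPencil n ι} {B : LinearPencil n κ}
    (h : A.SDFPSolvable B) : A.extend.SDFPSolvable B := by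
  obtain ⟨C, hC, h⟩ := h
  exact (extend_sdfpSolvable_iff A B).2
    ⟨C, hC, fun p => h p.succ, by rw [h 0, sub_self]; exact Matrix.PosSemidef.zero⟩

omit [Fintype ι] in
theorem containsPosDef_of_extend [Finite ι] {A : LinearPencil n ι}
    (h : ContainsPosDef A.extend.coeffSpan) :
    ContainsPosDef A.coeffSpan := by
  obtain ⟨X, hX, hpos⟩ := h
  obtain ⟨c, rfl⟩ := (Submodule.mem_span_range_iff_exists_fun ℝ).1 hX
  rw [sum_smul_extend] at hpos
  exact ⟨∑ p, c p • A.coeff p, Submodule.sum_mem _ fun p _ => Submodule.smul_mem _ _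
    (Submodule.subset_span ⟨p, rfl⟩), hpos.submatrix Sum.inr_injective⟩

end Extend

/-! ### Bounded spectrahedra: removing the extension. -/

section Bounded

theorem eq_zero_of_isBounded {A : LinearPencil n ι} (hne : A.spectrahedron.Nonempty)
    (hb : Bornology.IsBounded A.spectrahedron) {y : Fin n → ℝ}
    (hy : (∑ p : Fin n, y p • A.coeff p.succ).PosSemidef) : y = 0 := by
  obtain ⟨x, hx⟩ := hne
  by_contra h
  have hpos : 0 < ‖y‖ := norm_pos_iff.2 h
  obtain ⟨M, hM⟩ := hb.exists_norm_le
  have hM0 : 0 ≤ M := (norm_nonneg x).trans (hM x hx)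
  have h1 := hM _ (add_smul_mem_spectrahedron hx hy
    (t := (M + ‖x‖ + 1) / ‖y‖) (by positivity))
  have h2 : ‖((M + ‖x‖ + 1) / ‖y‖) • y‖ = M + ‖x‖ + 1 := by
    rw [norm_smul, Real.norm_of_nonneg (by positivity), div_mul_cancel₀ _ hpos.ne']
  have h3 := norm_sub_le (x + ((M + ‖x‖ + 1) / ‖y‖) • y) x
  rw [add_sub_cancel_left, h2] at h3
  linarith

/-- If `c 0 ≤ 0`, adding `-c 0 • A(x)` for some `x` in `S_A` gives a recession direction, which
boundedness forces to vanish; so `c = c 0 • (1, x)`. If `c 0 < 0`, both `A(x)` and `-A(x)` are PSD,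
hence `A(x) = 0`, against independence. -/
theorem eq_zero_or_pos_of_isBounded [Finite ι] {A : LinearPencil n ι} (hA : LinearIndependent ℝ A.coeff)
    (hne : A.spectrahedron.Nonempty) (hb : Bornology.IsBounded A.spectrahedron)
    {c : Fin (n + 1) → ℝ} (hc : (∑ p, c p • A.coeff p).PosSemidef) : c = 0 ∨ 0 < c 0 := by
  by_contra! hcon
  obtain ⟨hc0, hle⟩ := hcon
  obtain ⟨x, hx⟩ := hne
  have hmem : (∑ p : Fin n, (c p.succ - c 0 * x p) • A.coeff p.succ).PosSemidef := by
    have h1 := hc.add (Matrix.PosSemidef.smul (show (A.eval x).PosSemidef from hx)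
      (neg_nonneg.2 hle))
    convert h1 using 1
    rw [Fin.sum_univ_succ, eval]
    simp only [sub_smul, Finset.sum_sub_distrib, smul_add, Finset.smul_sum, smul_smul, neg_smul,
      neg_mul, Finset.sum_neg_distrib]
    abel
  have hz := eq_zero_of_isBounded ⟨x, hx⟩ hb hmem
  have hsucc : ∀ p : Fin n, c p.succ = c 0 * x p := fun p => sub_eq_zero.1 (congrFun hz p)
  rcases hle.eq_or_lt with h0 | h0
  · refine hc0 (funext fun p => Fin.cases h0 (fun p => ?_) p)
    simp [hsucc, h0]
  · have hev : ∑ p, c p • A.coeff p = c 0 • A.eval x := by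
      rw [sum_smul_eq _ _ h0.ne]
      congr 2
      ext p
      rw [hsucc, mul_div_cancel_left₀ _ h0.ne]
    have hnonpos : (-A.eval x).PosSemidef := by
      have := hc.smul (inv_nonneg.2 (neg_nonneg.2 h0.le))
      rw [hev, smul_smul] at this
      rwa [inv_neg, neg_mul, inv_mul_cancel₀ h0.ne, neg_one_smul] at this
    have hzero := eq_zero_of_posSemidef_neg hx hnonpos
    rw [eval_eq_sum] at hzero
    exact one_ne_zero (Fintype.linearIndependent_iff.1 hA _ hzero 0)

/-- Boundedness supplies the inequality `0 ≤ c 0` that otherwise comes from the additional block. -/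
theorem subset_iff_isPositiveMap_coeffMap [Finite ι] [Fintype κ] {A : LinearPencil n ι} (B : LinearPencil n κ)
    (hne : A.spectrahedron.Nonempty) (hb : Bornology.IsBounded A.spectrahedron)
    (hA : LinearIndependent ℝ A.coeff) :
    A.spectrahedron ⊆ B.spectrahedron ↔ IsPositiveMap (A.coeffMap B hA) := by
  rw [isPositiveMap_coeffMap_iff]
  refine ⟨fun h c hc => posSemidef_sum_of_subset hne h ?_ hc,
    fun h => subset_of_posSemidef_sum fun c h0 hc => h c hc⟩
  rcases eq_zero_or_pos_of_isBounded hA hne hb hc with rfl | h0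
  · rfl
  · exact h0.le

/-- The constant pencil `1` of size one. -/
def one (n : ℕ) : LinearPencil n Unit where
  coeff p := if p = 0 then 1 else 0
  symm p := by
    split_ifs
    · exact Matrix.isSymm_one
    · exact Matrix.isSymm_zero

variable [Fintype ι] [Fintype κ]

/-- If the spectrahedron is bounded, then `1 = ⟨W, A(x)⟩` for some positive semidefinite `W`. -/
theorem sdfpSolvable_one {A : LinearPencil n ι} (hA : LinearIndependent ℝ A.coeff)
    (hne : A.spectrahedron.Nonempty) (hb : Bornology.IsBounded A.spectrahedron) :
    A.SDFPSolvable (one n) := by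
  rw [sdfpSolvable_iff]
  by_contra h
  -- Weak separation needs no closedness. The functional is a vector `c` with `∑ c_p A_p` PSD whose
  -- value at the constant pencil is `c 0`; `c = 0` contradicts `f ≠ 0`, and `c 0 > 0` contradicts
  -- the separation.
  obtain ⟨f, hf0, hle, hf⟩ := (A.sdfpCone Unit).exists_ne_zero_of_notMem h
  obtain ⟨Λ, -, hΛ, hpsd⟩ := A.exists_dual_matrices f hf
  have hc : (∑ p, Λ p () () • A.coeff p).PosSemidef := by
    convert hpsd.submatrix (fun i : ι => ((), i)) using 1
    ext i j
    simp [Matrix.sum_apply]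
  rcases eq_zero_or_pos_of_isBounded hA hne hb hc with h0 | h0
  · refine hf0 (LinearMap.ext fun b => ?_)
    rw [hΛ b fun _ _ _ => rfl]
    simp [fun p => congrFun h0 p]
  · rw [hΛ _ fun _ _ _ => rfl] at hle
    simp [one, Fin.sum_univ_succ, Fin.succ_ne_zero] at hle
    exact hle.not_gt h0

/-- Since `1 = ⟨W, A(x)⟩`, the slack is `D = ∑ A(x)_ij W_ij D`, and `C + W ⊗ D` solves the problem
without the extension. -/
theorem sdfpSolvable_of_extend {A : LinearPencil n ι} {B : LinearPencil n κ}
    (hA : LinearIndependent ℝ A.coeff) (hne : A.spectrahedron.Nonempty)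
    (hb : Bornology.IsBounded A.spectrahedron) (h : A.extend.SDFPSolvable B) :
    A.SDFPSolvable B := by
  obtain ⟨W, hW, hW1⟩ := sdfpSolvable_one hA hne hb
  obtain ⟨C, hC, hs, h0⟩ := (extend_sdfpSolvable_iff A B).1 h
  set D := B.coeff 0 - ∑ i, ∑ j, A.coeff 0 i j • C i j with hD
  have hW' : ∀ p, ∑ i, ∑ j, A.coeff p i j * W i j () () = if p = 0 then 1 else 0 := by
    intro p
    have := congrFun (congrFun (hW1 p) ()) ()
    simp only [Matrix.sum_apply, Matrix.smul_apply, smul_eq_mul] at this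
    rw [← this, one]
    split_ifs with h <;> simp [h]
  refine ⟨Matrix.of fun i j => C i j + W i j () () • D, ?_, fun p => ?_⟩
  · refine hC.add (B := Matrix.of fun x y : ι × κ => W x.1 y.1 () () * D x.2 y.2) ?_
    exact (hW.submatrix fun i : ι => (i, ())).kronecker h0
  · simp only [Matrix.of_apply, smul_add, Finset.sum_add_distrib, smul_smul, ← Finset.sum_smul, hW']
    refine Fin.cases ?_ (fun p => ?_) p
    · simp [hD]
    · simp [Fin.succ_ne_zero, hs p]

end Bounded

end LinearPencil

/-! ### Pencils as polynomial matrices, and the sum-of-squares program. -/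

namespace LinearPencil

variable {n : ℕ} {ι κ σ : Type}

theorem toPoly_apply (A : LinearPencil n ι) (v : Fin n → σ) (i j : ι) :
    A.toPoly v i j = MvPolynomial.C (A.coeff 0 i j) +
      ∑ p : Fin n, MvPolynomial.X (v p) * MvPolynomial.C (A.coeff p.succ i j) := by
  simp [toPoly, Matrix.sum_apply]

theorem eval_toPoly (A : LinearPencil n ι) (v : Fin n → σ) (y : σ → ℝ) (i j : ι) :
    MvPolynomial.eval y (A.toPoly v i j) = A.eval (fun p => y (v p)) i j := by
  simp [toPoly_apply, eval, Matrix.sum_apply]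

/-- The pencil `B(x) + c I`. -/
def addConst [DecidableEq κ] (B : LinearPencil n κ) (c : ℝ) : LinearPencil n κ where
  coeff p := B.coeff p + if p = 0 then c • 1 else 0
  symm p := by
    refine (B.symm p).add ?_
    split_ifs
    · exact Matrix.isSymm_one.smul c
    · exact Matrix.isSymm_zero

theorem eval_addConst [DecidableEq κ] (B : LinearPencil n κ) (c : ℝ) (x : Fin n → ℝ) :
    (B.addConst c).eval x = B.eval x + c • 1 := by
  simp [eval, addConst, Fin.succ_ne_zero, add_right_comm]

/-- The pencil `B(x) - ∑_{i,j} A(x)_ij C_ij`. -/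
def residual [Fintype ι] (A : LinearPencil n ι) (B : LinearPencil n κ)
    (C : Matrix ι ι (Matrix κ κ ℝ)) (hC : (Matrix.comp ι ι κ κ ℝ C).PosSemidef) :
    LinearPencil n κ where
  coeff p := B.coeff p - ∑ i, ∑ j, A.coeff p i j • C i j
  symm p := by
    refine (B.symm p).sub ?_
    ext s t
    simp only [Matrix.transpose_apply, Matrix.sum_apply, Matrix.smul_apply]
    rw [Finset.sum_comm]
    refine Finset.sum_congr rfl fun i _ => Finset.sum_congr rfl fun j _ => ?_
    rw [(A.symm p).apply, show C j i t s = C i j s t by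
      simpa using hC.1.apply (i, s) (j, t)]

theorem eval_residual [Fintype ι] (A : LinearPencil n ι) (B : LinearPencil n κ)
    (C : Matrix ι ι (Matrix κ κ ℝ)) (hC : (Matrix.comp ι ι κ κ ℝ C).PosSemidef) (x : Fin n → ℝ) :
    (A.residual B C hC).eval x = B.eval x - ∑ i, ∑ j, A.eval x i j • C i j := by
  simp only [eval_eq_sum, residual, smul_sub, Finset.sum_sub_distrib, Matrix.sum_apply,
    Finset.sum_smul, Finset.smul_sum, Matrix.smul_apply, smul_assoc]
  rw [← sum_rotate]

end LinearPencil

section Sos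

variable {n : ℕ} {ι κ σ : Type}

theorem IsSosMatrix.posSemidef_eval [Fintype ι] {M : Matrix ι ι (MvPolynomial σ ℝ)}
    (h : IsSosMatrix M) (x : σ → ℝ) :
    (Matrix.of fun i j => MvPolynomial.eval x (M i j)).PosSemidef := by
  obtain ⟨m, -, U, rfl⟩ := h
  exact posSemidef_of_gram (fun i c => MvPolynomial.eval x (U i c)) fun i j => by
    simp [Matrix.mul_apply]

theorem isSosMatrix_C [Finite ι] {M : Matrix ι ι ℝ} (hM : M.PosSemidef) :
    IsSosMatrix (Matrix.of fun i j => (MvPolynomial.C (M i j) : MvPolynomial σ ℝ)) := by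
  obtain ⟨m, V, hV⟩ := hM.exists_gram
  -- A zero column is added because `IsSosMatrix` requires at least one column.
  refine ⟨m + 1, m.succ_pos, Matrix.of fun i c =>
    MvPolynomial.C ((Fin.cons 0 (V i) : Fin (m + 1) → ℝ) c), ?_⟩
  ext1 i j
  simp [Matrix.mul_apply, hV, Fin.sum_univ_succ]

variable [Fintype ι] [Fintype κ] [DecidableEq κ]

omit [Fintype κ] in
theorem SosFeasible.mono {A : LinearPencil n ι} {B : LinearPencil n κ} {t t' : ℕ} {lam : ℝ}
    (h : SosFeasible A B t lam) (ht : t ≤ t') : SosFeasible A B t' lam := by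
  obtain ⟨S, hdeg, h⟩ := h
  exact ⟨S, fun i j a b => (hdeg i j a b).trans (by omega), h⟩

/-- The sum-of-squares program of order zero is the semidefinite feasibility problem for the
extended pencil. -/
theorem sosFeasible_zero_iff (A : LinearPencil n ι) (B : LinearPencil n κ) (lam : ℝ) :
    SosFeasible A B 0 lam ↔ A.extend.SDFPSolvable (B.addConst (-lam)) := by
  rw [LinearPencil.extend_sdfpSolvable_iff]
  constructor
  · rintro ⟨S, hdeg, hS, hB⟩
    have hconst : ∀ i j a b x, MvPolynomial.eval x (S i j a b) =
        MvPolynomial.constantCoeff (S i j a b) := by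
      intro i j a b x
      rw [MvPolynomial.totalDegree_eq_zero_iff_eq_C.1 (Nat.le_zero.1 (hdeg i j a b))]
      simp
    let C : Matrix ι ι (Matrix κ κ ℝ) := Matrix.of fun a b => Matrix.of fun i j =>
      MvPolynomial.constantCoeff (S i j a b)
    have hC : (Matrix.comp ι ι κ κ ℝ C).PosSemidef := by
      -- The blocks of `S` are indexed by `κ` and those of `C` by `ι`; the swap exchanges the two
      -- tensor factors.
      convert (hS.posSemidef_eval 0).submatrix Prod.swap using 1
      ext x y
      simp [C, Matrix.comp_apply]
    let D := A.residual (B.addConst (-lam)) C hC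
    have hD : ∀ x, x ∈ D.spectrahedron := by
      intro x
      change ((A.residual (B.addConst (-lam)) C hC).eval x).PosSemidef
      rw [LinearPencil.eval_residual, LinearPencil.eval_addConst]
      convert hB.posSemidef_eval x using 1
      ext i j
      simp [LinearPencil.eval_toPoly, hconst, C, Matrix.sum_apply, Matrix.one_apply, mul_comm,
        apply_ite (MvPolynomial.eval x), sub_eq_add_neg]
    have hy : ∀ y : Fin n → ℝ, (∑ p : Fin n, y p • D.coeff p.succ).PosSemidef := fun y =>
      D.posSemidef_of_add_smul_mem (x := 0) fun t _ => hD _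
    refine ⟨C, hC, fun p => ?_, ?_⟩
    -- The residual pencil is PSD everywhere, so both signs of each coordinate direction are
    -- recession directions and its linear coefficients vanish.
    · have h1 := hy (Pi.single p 1)
      have h2 := hy (Pi.single p (-1))
      simp only [Pi.single_apply, ite_smul, zero_smul, Finset.sum_ite_eq', Finset.mem_univ,
        if_true, one_smul, neg_smul] at h1 h2
      exact sub_eq_zero.1 (eq_zero_of_posSemidef_neg h1 h2)
    · have h0 : (D.eval 0).PosSemidef := hD 0
      rwa [show D.eval 0 = D.coeff 0 by simp [LinearPencil.eval]] at h0
  · rintro ⟨C, hC, hs, h0⟩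
    refine ⟨Matrix.of fun i j => Matrix.of fun a b => MvPolynomial.C (C a b i j),
      fun i j a b => by simp, ?_, ?_⟩
    · exact isSosMatrix_C (hC.submatrix Prod.swap)
    · convert isSosMatrix_C h0 using 1
      ext1 i j
      refine MvPolynomial.funext fun x => ?_
      have h1 := congrFun (congrFun (A.eval_residual (B.addConst (-lam)) C hC x) i) j
      have h2 : (A.residual (B.addConst (-lam)) C hC).eval x =
          (B.addConst (-lam)).coeff 0 - ∑ i, ∑ j, A.coeff 0 i j • C i j := by
        simp [LinearPencil.eval, LinearPencil.residual, hs]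
      rw [h2, LinearPencil.eval_addConst] at h1
      rw [Matrix.of_apply, MvPolynomial.eval_C, h1]
      simp [LinearPencil.eval_toPoly, Matrix.sum_apply, Matrix.one_apply, mul_comm,
        apply_ite (MvPolynomial.eval x), sub_eq_add_neg]

theorem LinearPencil.SDFPSolvable.of_addConst_neg {A : LinearPencil n ι} {B : LinearPencil n κ}
    {lam : ℝ} (hlam : 0 ≤ lam) (h : A.extend.SDFPSolvable (B.addConst (-lam))) :
    A.extend.SDFPSolvable B := by
  obtain ⟨C, hC, hs, h0⟩ := (extend_sdfpSolvable_iff A _).1 h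
  refine (extend_sdfpSolvable_iff A B).2 ⟨C, hC, fun p => ?_, ?_⟩
  · simpa [addConst, Fin.succ_ne_zero] using hs p
  · convert h0.add (Matrix.PosSemidef.one.smul hlam) using 1
    simp only [addConst, if_true, neg_smul]
    abel

theorem sdfpSolvable_extend_iff_sosFeasible (A : LinearPencil n ι) (B : LinearPencil n κ) :
    A.extend.SDFPSolvable B ↔ ∃ lam : ℝ, 0 ≤ lam ∧ SosFeasible A B 0 lam := by
  constructor
  · intro h
    refine ⟨0, le_rfl, (sosFeasible_zero_iff A B 0).2 ?_⟩
    have : B.addConst (-0) = B := by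
      cases B
      simp [LinearPencil.addConst]
    rwa [this]
  · rintro ⟨lam, hlam, h⟩
    exact ((sosFeasible_zero_iff A B lam).1 h).of_addConst_neg hlam

omit [Fintype κ] in
theorem zero_le_lambdaSos_iff (A : LinearPencil n ι) (B : LinearPencil n κ) (t : ℕ) :
    0 ≤ lambdaSos A B t ↔ ∀ ε : ℝ, 0 < ε → ∃ lam, -ε < lam ∧ SosFeasible A B t lam := by
  constructor
  · intro h ε hε
    have : ((-ε : ℝ) : EReal) < lambdaSos A B t := lt_of_lt_of_le (by exact_mod_cast (by linarith)) h
    rw [lambdaSos, lt_iSup_iff] at this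
    obtain ⟨lam, h⟩ := this
    obtain ⟨hf, h⟩ := lt_iSup_iff.1 h
    exact ⟨lam, by exact_mod_cast h, hf⟩
  · intro h
    refine EReal.ge_of_forall_gt_iff_ge.1 fun z hz => ?_
    have hz' : z < 0 := by exact_mod_cast hz
    obtain ⟨lam, hlam, hf⟩ := h (-z) (by linarith)
    refine le_trans ?_ (le_iSup₂ (f := fun (lam : ℝ) (_ : SosFeasible A B t lam) => (lam : EReal))
      lam hf)
    exact_mod_cast (by linarith)

omit [Fintype κ] in
theorem zero_le_lambdaSos_of_feasible {A : LinearPencil n ι} {B : LinearPencil n κ} {t : ℕ}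
    {lam : ℝ} (hlam : 0 ≤ lam) (h : SosFeasible A B t lam) : 0 ≤ lambdaSos A B t :=
  (zero_le_lambdaSos_iff A B t).2 fun _ hε => ⟨lam, by linarith, h⟩

omit [Fintype κ] in
theorem zero_le_lambdaSos_mono {A : LinearPencil n ι} {B : LinearPencil n κ} {t t' : ℕ}
    (ht : t ≤ t') (h : 0 ≤ lambdaSos A B t) : 0 ≤ lambdaSos A B t' := by
  rw [zero_le_lambdaSos_iff] at h ⊢
  exact fun ε hε => (h ε hε).imp fun lam hl => ⟨hl.1, hl.2.mono ht⟩

/-- If the span of the extended pencil contains a positive definite matrix, the sum-of-squares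
program of order zero attains nonnegativity. -/
theorem sdfpSolvable_extend_of_zero_le_lambdaSos {A : LinearPencil n ι} {B : LinearPencil n κ}
    (hpos : ContainsPosDef A.extend.coeffSpan) (h : 0 ≤ lambdaSos A B 0) :
    A.extend.SDFPSolvable B := by
  rw [zero_le_lambdaSos_iff] at h
  by_cases hex : ∃ lam : ℝ, 0 ≤ lam ∧ SosFeasible A B 0 lam
  · exact (sdfpSolvable_extend_iff_sosFeasible A B).2 hex
  -- With no nonnegative feasible value, these lie between `-1/(k+1)` and zero, so the solvable
  -- right-hand sides `B - lam k • I` converge to `B`.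
  choose lam hlam hf using fun k : ℕ => h (1 / ((k : ℝ) + 1)) Nat.one_div_pos_of_nat
  have hlim : Filter.Tendsto lam Filter.atTop (nhds 0) := by
    refine squeeze_zero_norm (fun k => ?_) tendsto_one_div_add_atTop_nhds_zero_nat
    have hneg : lam k < 0 := by
      by_contra! hk
      exact hex ⟨_, hk, hf k⟩
    rw [Real.norm_of_nonpos hneg.le]
    linarith [hlam k]
  rw [LinearPencil.sdfpSolvable_iff]
  refine (LinearPencil.isClosed_sdfpCone hpos κ).mem_of_tendsto (b := Filter.atTop)
    (f := fun k p s t => (B.addConst (-lam k)).coeff p s t) ?_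
    (Filter.Eventually.of_forall fun k => (LinearPencil.sdfpSolvable_iff _ _).1
      ((sosFeasible_zero_iff A B _).1 (hf k)))
  simp only [tendsto_pi_nhds]
  intro p s t
  have : Filter.Tendsto (fun k => B.coeff p s t +
      (if p = 0 then -lam k * (1 : Matrix κ κ ℝ) s t else 0)) Filter.atTop
      (nhds (B.coeff p s t + if p = 0 then -0 * (1 : Matrix κ κ ℝ) s t else 0)) := by
    refine tendsto_const_nhds.add ?_
    split_ifs
    · exact hlim.neg.mul_const _
    · exact tendsto_const_nhds
  convert this using 2
  · simp only [LinearPencil.addConst, Matrix.add_apply]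
    split_ifs <;> simp
  · simp

end Sos

/-! ### The functional `L_y` and the moment relaxation. -/

section Linearize

open MvPolynomial

variable {σ : Type}

theorem linearize_eq_sum (y : (σ →₀ ℕ) → ℝ) {p : MvPolynomial σ ℝ} {s : Finset (σ →₀ ℕ)}
    (hs : p.support ⊆ s) : linearize y p = ∑ α ∈ s, p.coeff α * y α :=
  Finset.sum_subset hs fun α _ hα => by rw [notMem_support_iff.1 hα, zero_mul]

/-- `L_y` as a linear functional. -/
def linearizeHom (y : (σ →₀ ℕ) → ℝ) : MvPolynomial σ ℝ →ₗ[ℝ] ℝ where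
  toFun := linearize y
  map_add' p q := by
    classical
    rw [linearize_eq_sum y (s := p.support ∪ q.support) support_add,
      linearize_eq_sum y (p := p) (s := p.support ∪ q.support) Finset.subset_union_left,
      linearize_eq_sum y (p := q) (s := p.support ∪ q.support) Finset.subset_union_right,
      ← Finset.sum_add_distrib]
    exact Finset.sum_congr rfl fun α _ => by rw [coeff_add, add_mul]
  map_smul' c p := by
    rw [linearize_eq_sum y (s := p.support) support_smul, linearize]
    simp [Finset.mul_sum, mul_assoc]

theorem linearizeHom_apply (y : (σ →₀ ℕ) → ℝ) (p : MvPolynomial σ ℝ) :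
    linearizeHom y p = linearize y p := rfl

theorem linearizeHom_C_mul (y : (σ →₀ ℕ) → ℝ) (c : ℝ) (p : MvPolynomial σ ℝ) :
    linearizeHom y (C c * p) = c * linearizeHom y p := by
  rw [C_mul', map_smul, smul_eq_mul]

theorem linearizeHom_monomial (y : (σ →₀ ℕ) → ℝ) (α : σ →₀ ℕ) (c : ℝ) :
    linearizeHom y (monomial α c) = c * y α := by
  classical
  rw [linearizeHom_apply, linearize_eq_sum y support_monomial_subset, Finset.sum_singleton,
    coeff_monomial, if_pos rfl]

theorem linearize_eval (x : σ → ℝ) (p : MvPolynomial σ ℝ) :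
    linearize (fun α => α.prod fun i k => x i ^ k) p = eval x p := by
  rw [eval_eq, linearize]
  rfl

theorem X_mul_X_eq_monomial (a b : σ) : (X a * X b : MvPolynomial σ ℝ) =
    monomial (Finsupp.single a 1 + Finsupp.single b 1) 1 := by
  rw [X, X, monomial_mul, one_mul]

end Linearize

section Moments

open MvPolynomial

variable {n : ℕ} {ι κ : Type}

theorem zero_le_muMom_iff [Fintype κ] (A : LinearPencil n ι) (B : LinearPencil n κ) (r R : ℝ)
    (t : ℕ) :
    0 ≤ muMom A B r R t ↔ ∀ y, MomentFeasible κ A r R t y → 0 ≤ linearize y (quadForm B) := by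
  simp [muMom, le_iInf_iff]

theorem MomentFeasible.anti [Fintype κ] {A : LinearPencil n ι} {r R : ℝ} {t t' : ℕ} (ht : t ≤ t')
    {y : (Fin n ⊕ κ →₀ ℕ) → ℝ} (h : MomentFeasible κ A r R t' y) :
    MomentFeasible κ A r R t y := by
  obtain ⟨h0, hM, hL⟩ := h
  have ht' : t - 1 ≤ t' - 1 := by omega
  have h1 := hM.submatrix fun α : {α : Fin n ⊕ κ →₀ ℕ // α.degree ≤ t} =>
    (⟨α.1, α.2.trans ht⟩ : {α : Fin n ⊕ κ →₀ ℕ // α.degree ≤ t'})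
  have h2 := hL.submatrix fun x : {α : Fin n ⊕ κ →₀ ℕ // α.degree ≤ t - 1} × (ι ⊕ Fin 2) =>
    ((⟨x.1.1, x.1.2.trans ht'⟩, x.2) :
      {α : Fin n ⊕ κ →₀ ℕ // α.degree ≤ t' - 1} × (ι ⊕ Fin 2))
  exact ⟨h0, h1, h2⟩

theorem zero_le_muMom_mono [Fintype κ] {A : LinearPencil n ι} {B : LinearPencil n κ} {r R : ℝ}
    {t t' : ℕ} (ht : t ≤ t') (h : 0 ≤ muMom A B r R t) : 0 ≤ muMom A B r R t' := by
  rw [zero_le_muMom_iff] at h ⊢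
  exact fun y hy => h y (hy.anti ht)

theorem eval_normSqZ [Fintype κ] (w : Fin n ⊕ κ → ℝ) :
    eval w (normSqZ n κ) = ∑ s, w (Sum.inr s) * w (Sum.inr s) := by
  simp [normSqZ]

theorem eval_quadForm [Fintype κ] (B : LinearPencil n κ) (w : Fin n ⊕ κ → ℝ) :
    eval w (quadForm B) = ∑ s, ∑ t, B.eval (fun p => w (Sum.inl p)) s t *
      (w (Sum.inr s) * w (Sum.inr t)) := by
  simp only [quadForm, map_sum, map_mul, eval_X, LinearPencil.eval_toPoly]
  exact Finset.sum_congr rfl fun s _ => Finset.sum_congr rfl fun t _ => by ring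

/-- The evaluation at a feasible point gives a feasible moment sequence. -/
theorem momentFeasible_eval [Finite ι] [Fintype κ] {A : LinearPencil n ι} {r R : ℝ} (t : ℕ)
    {w : Fin n ⊕ κ → ℝ} (hx : (fun p => w (Sum.inl p)) ∈ A.spectrahedron)
    (hr : r ^ 2 ≤ ∑ s, w (Sum.inr s) * w (Sum.inr s))
    (hR : ∑ s, w (Sum.inr s) * w (Sum.inr s) ≤ R ^ 2) :
    MomentFeasible κ A r R t fun α => α.prod fun i k => w i ^ k := by
  have hfin : ∀ t, Finite {α : Fin n ⊕ κ →₀ ℕ // α.degree ≤ t} := fun t =>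
    (Finsupp.finite_of_degree_le t).to_subtype
  have := Fintype.ofFinite ι
  have hadd : ∀ α β : Fin n ⊕ κ →₀ ℕ, ((α + β).prod fun i k => w i ^ k) =
      (α.prod fun i k => w i ^ k) * β.prod fun i k => w i ^ k := fun α β =>
    Finsupp.prod_add_index' (by simp) (by simp [pow_add])
  refine ⟨by simp, ?_, ?_⟩
  · have := hfin t
    convert (Matrix.PosSemidef.one (n := Unit) (R := ℝ)).mul_submatrix
      (fun _ : {α : Fin n ⊕ κ →₀ ℕ // α.degree ≤ t} => ())
      (fun α => α.1.prod fun i k => w i ^ k) using 1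
    ext α β
    simp [momentMatrix, hadd]
  · have := hfin (t - 1)
    -- For a point evaluation the localizing matrix is the value of the constraint at `w`, repeated
    -- over monomials and rescaled by their values.
    have hG : (Matrix.of fun i j => eval w (constraintMatrix κ A r R i j)).PosSemidef := by
      obtain ⟨hs, hv⟩ := posSemidef_iff_sum.1 hx
      refine posSemidef_iff_sum.2 ⟨?_, fun v => ?_⟩
      · rintro (i | i) (j | j)
        · simpa [constraintMatrix, LinearPencil.eval_toPoly] using hs i j
        · simp [constraintMatrix]
        · simp [constraintMatrix]
        · by_cases h : i = j
          · rw [h]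
          · simp [constraintMatrix, Matrix.diagonal_apply_ne _ h,
              Matrix.diagonal_apply_ne _ (Ne.symm h)]
      · refine (add_nonneg (hv fun i => v (Sum.inl i)) (add_nonneg
          (mul_nonneg (sub_nonneg.2 hr) (mul_self_nonneg (v (Sum.inr 0))))
          (mul_nonneg (sub_nonneg.2 hR) (mul_self_nonneg (v (Sum.inr 1)))))).trans_eq ?_
        simp [constraintMatrix, LinearPencil.eval_toPoly, eval_normSqZ]
    convert hG.mul_submatrix
      (fun x : {α : Fin n ⊕ κ →₀ ℕ // α.degree ≤ t - 1} × (ι ⊕ Fin 2) => x.2)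
      (fun x => x.1.1.prod fun i k => w i ^ k) using 1
    ext a b
    simp only [localizingMatrix, Matrix.of_apply, linearize_eval, map_mul, eval_monomial, one_mul,
      hadd]
    ring

/-- A nonzero `v` is rescaled to norm `r`; evaluation at `(x, c • v)` is then feasible with
objective value `c ^ 2` times the quadratic form of `B(x)` at `v`. -/
theorem subset_of_zero_le_muMom [Finite ι] [Fintype κ] {A : LinearPencil n ι}
    {B : LinearPencil n κ} {r R : ℝ} (hr : 0 < r) (hrR : r ≤ R) {t : ℕ}
    (h : 0 ≤ muMom A B r R t) : A.spectrahedron ⊆ B.spectrahedron := by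
  rw [zero_le_muMom_iff] at h
  intro x hx
  refine posSemidef_iff_sum.2 ⟨fun i j => ?_, fun v => ?_⟩
  · rw [B.eval_eq_sum]
    exact (B.isSymm_sum_smul id _).apply j i
  by_cases hv : v = 0
  · simp [hv]
  have hpos : 0 < ∑ s, v s * v s := by
    refine (Finset.sum_nonneg fun s _ => mul_self_nonneg (v s)).lt_of_ne' fun h0 => hv ?_
    ext s
    exact mul_self_eq_zero.1 ((Finset.sum_eq_zero_iff_of_nonneg fun s _ =>
      mul_self_nonneg (v s)).1 h0 s (Finset.mem_univ s))
  set N := ∑ s, v s * v s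
  have hc : 0 < r / √N := div_pos hr (Real.sqrt_pos.2 hpos)
  have hcN : (r / √N) ^ 2 * N = r ^ 2 := by
    rw [div_pow, Real.sq_sqrt hpos.le, div_mul_cancel₀ _ hpos.ne']
  generalize r / √N = c at hc hcN
  have hnorm : ∑ s, c * v s * (c * v s) = r ^ 2 := by
    rw [← hcN, Finset.mul_sum]
    exact Finset.sum_congr rfl fun s _ => by ring
  have h1 := h _ (momentFeasible_eval (A := A) (r := r) (R := R) t
    (w := Sum.elim x fun s => c * v s) hx hnorm.ge (hnorm.trans_le (by gcongr)))
  rw [linearize_eval, eval_quadForm] at h1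
  simp only [Sum.elim_inl, Sum.elim_inr] at h1
  have h2 : ∑ s, ∑ t, B.eval x s t * (c * v s * (c * v t)) =
      c ^ 2 * ∑ s, ∑ t, B.eval x s t * (v s * v t) := by
    simp only [Finset.mul_sum]
    exact Finset.sum_congr rfl fun s _ => Finset.sum_congr rfl fun t _ => by ring
  rw [h2] at h1
  exact nonneg_of_mul_nonneg_right h1 (by positivity)

variable [Fintype ι] [Fintype κ] [DecidableEq κ]

/-- The certificate as a polynomial identity in `(x, z)`, arranged so that `L_y` of the second and
third terms is a trace product with part of the moment and of the localizing matrix. -/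
theorem quadForm_eq {A : LinearPencil n ι} {B : LinearPencil n κ} {lam : ℝ}
    {D : Matrix κ κ ℝ} {S : Matrix ι ι (Matrix κ κ ℝ)}
    (h : ∀ x, B.eval x = lam • 1 + D + ∑ i, ∑ j, A.eval x i j • S i j) :
    quadForm B = C lam * normSqZ n κ +
      ∑ s, ∑ t, C (D s t) * (X (Sum.inr s) * X (Sum.inr t)) +
      ∑ x : ι × κ, ∑ y : ι × κ, C (Matrix.comp ι ι κ κ ℝ S x y) *
        (X (Sum.inr x.2) * X (Sum.inr y.2) * A.toPoly Sum.inl x.1 y.1) := by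
  refine MvPolynomial.funext fun w => ?_
  rw [eval_quadForm, h]
  simp only [map_add, map_mul, map_sum, eval_C, eval_X, eval_normSqZ, LinearPencil.eval_toPoly,
    Matrix.add_apply, Matrix.smul_apply, smul_eq_mul, add_mul, Finset.sum_add_distrib,
    Matrix.sum_apply]
  congr 1
  · congr 1
    simp [Matrix.one_apply, Finset.mul_sum]
  · simp only [Fintype.sum_prod_type, Finset.sum_mul, Matrix.comp_apply]
    rw [Finset.sum_comm (γ := ι)]
    refine Finset.sum_congr rfl fun s _ => ?_
    rw [← sum_rotate]
    refine Finset.sum_congr rfl fun i _ => Finset.sum_congr rfl fun j _ =>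
      Finset.sum_congr rfl fun t _ => by ring

theorem MomentFeasible.linearize_nonneg {A : LinearPencil n ι} {B : LinearPencil n κ} {r R : ℝ}
    {lam : ℝ} (h : A.extend.SDFPSolvable (B.addConst (-lam)))
    {y : (Fin n ⊕ κ →₀ ℕ) → ℝ} (hy : MomentFeasible κ A r R 2 y) :
    lam * linearize y (normSqZ n κ) ≤ linearize y (quadForm B) := by
  obtain ⟨S, hS, hs, hD⟩ := (LinearPencil.extend_sdfpSolvable_iff A _).1 h
  obtain ⟨-, hM, hL⟩ := hy
  have hB : ∀ x, B.eval x = lam • 1 + ((B.addConst (-lam)).coeff 0 -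
      ∑ i, ∑ j, A.coeff 0 i j • S i j) + ∑ i, ∑ j, A.eval x i j • S i j := by
    intro x
    have h1 := A.eval_residual (B.addConst (-lam)) S hS x
    have h2 : (A.residual (B.addConst (-lam)) S hS).eval x =
        (B.addConst (-lam)).coeff 0 - ∑ i, ∑ j, A.coeff 0 i j • S i j := by
      simp [LinearPencil.eval, LinearPencil.residual, hs]
    rw [← h2, h1, LinearPencil.eval_addConst, neg_smul]
    abel
  generalize (B.addConst (-lam)).coeff 0 - ∑ i, ∑ j, A.coeff 0 i j • S i j = D at hD hB
  rw [quadForm_eq hB, ← linearizeHom_apply, ← linearizeHom_apply]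
  simp only [map_add, map_sum, linearizeHom_C_mul, X_mul_X_eq_monomial]
  rw [add_assoc]
  refine le_add_of_nonneg_right (add_nonneg ?_ ?_)
  · simpa [linearizeHom_monomial, momentMatrix] using sum_mul_nonneg_of_posSemidef hD
      (hM.submatrix fun s : κ => ⟨Finsupp.single (Sum.inr s) 1, by simp⟩)
  · exact sum_mul_nonneg_of_posSemidef hS
      -- Order two is the least at which the localizing matrix, of level `t - 1`, has rows for the
      -- monomials `z_s`.
      (hL.submatrix fun x : ι × κ => (⟨Finsupp.single (Sum.inr x.2) 1, by simp⟩, Sum.inl x.1))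

omit [Fintype ι] [DecidableEq κ] in
-- The lower bound comes from the diagonal of the moment matrix at the `z_s`, the upper one from the
-- localizing entry of `R² - zᵀz` at the monomial `1`.
theorem MomentFeasible.linearize_normSqZ_mem {A : LinearPencil n ι} {r R : ℝ}
    {y : (Fin n ⊕ κ →₀ ℕ) → ℝ} (hy : MomentFeasible κ A r R 2 y) :
    linearize y (normSqZ n κ) ∈ Set.Icc 0 (R ^ 2) := by
  obtain ⟨h0, hM, hL⟩ := hy
  constructor
  · rw [← linearizeHom_apply, normSqZ, map_sum]
    refine Finset.sum_nonneg fun s _ => ?_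
    rw [X_mul_X_eq_monomial, linearizeHom_monomial, one_mul]
    exact hM.diag_nonneg (i := ⟨Finsupp.single (Sum.inr s) 1, by simp⟩)
  · have h1 := hL.diag_nonneg (i := (⟨0, by simp⟩, Sum.inr 1))
    have h2 : linearizeHom y (C (R ^ 2) : MvPolynomial (Fin n ⊕ κ) ℝ) = R ^ 2 := by
      rw [C_apply, linearizeHom_monomial, h0, mul_one]
    have h3 : localizingMatrix (2 - 1) (constraintMatrix κ A r R) y (⟨0, by simp⟩, Sum.inr 1)
        (⟨0, by simp⟩, Sum.inr 1) = linearizeHom y (C (R ^ 2) - normSqZ n κ) := by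
      simp [localizingMatrix, constraintMatrix, linearizeHom_apply]
    rw [h3, map_sub, h2, linearizeHom_apply] at h1
    linarith

theorem zero_le_muMom_of_zero_le_lambdaSos {A : LinearPencil n ι} {B : LinearPencil n κ} (r R : ℝ)
    (h : 0 ≤ lambdaSos A B 0) : 0 ≤ muMom A B r R 2 := by
  rw [zero_le_lambdaSos_iff] at h
  refine (zero_le_muMom_iff _ _ _ _ _).2 fun y hy => ?_
  obtain ⟨hN0, hNR⟩ := hy.linearize_normSqZ_mem
  refine le_of_forall_pos_le_add fun ε hε => ?_
  -- The feasible value may be negative, but it costs at most `ε` because `L_y(zᵀz) ≤ R²`. The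
  -- summand `1` keeps the denominator positive for every `R`.
  obtain ⟨lam, hlam, hf⟩ := h (ε / (R ^ 2 + 1)) (by positivity)
  have h1 := hy.linearize_nonneg ((sosFeasible_zero_iff A B lam).1 hf)
  have h2 : -(ε / (R ^ 2 + 1)) * linearize y (normSqZ n κ) ≤
      lam * linearize y (normSqZ n κ) := by gcongr
  have h3 : ε / (R ^ 2 + 1) * linearize y (normSqZ n κ) ≤ ε / (R ^ 2 + 1) * (R ^ 2 + 1) := by
    gcongr
    linarith
  rw [div_mul_cancel₀ _ (by positivity)] at h3
  linarith

end Moments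

end

/-! ### The full chain of implications. -/

theorem mainTheorem1 {n k l : ℕ} (A : LinearPencil n (Fin k)) (B : LinearPencil n (Fin l))
    (hne : A.spectrahedron.Nonempty) {r R : ℝ} (hr : 0 < r) (hrR : r ≤ R) :
    -- (1) holds if and only if some `lam ≥ 0` is feasible for the sos program of order 0
    (A.extend.SDFPSolvable B ↔ ∃ lam : ℝ, 0 ≤ lam ∧ SosFeasible A B 0 lam) ∧
    -- (1) implies (2'), and conversely if the extended span contains a positive definite matrix
    (A.extend.SDFPSolvable B → 0 ≤ lambdaSos A B 0) ∧
    (ContainsPosDef A.extend.coeffSpan → 0 ≤ lambdaSos A B 0 → A.extend.SDFPSolvable B) ∧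
    -- the supplement to (2')
    (0 ≤ lambdaSos A B 0 → ∀ t : ℕ, 0 ≤ lambdaSos A B t) ∧
    -- (2') implies (2)
    (0 ≤ lambdaSos A B 0 → 0 ≤ muMom A B r R 2) ∧
    -- the supplement to (2)
    (0 ≤ muMom A B r R 2 → ∀ t : ℕ, 2 ≤ t → 0 ≤ muMom A B r R t) ∧
    -- (2) implies (3)
    (0 ≤ muMom A B r R 2 → A.spectrahedron ⊆ B.spectrahedron) ∧
    -- solvability of the problem for `A` itself implies (1)
    (A.SDFPSolvable B → A.extend.SDFPSolvable B) ∧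
    -- (1) implies (1'), with the partial converse, and (3) is equivalent to (3')
    (∀ hA : LinearIndependent ℝ (fun p : Fin n => A.coeff p.succ),
      (A.extend.SDFPSolvable B → IsCompletelyPositiveMap (A.extendedMap B hA)) ∧
      (ContainsPosDef A.extend.coeffSpan →
        IsCompletelyPositiveMap (A.extendedMap B hA) → A.extend.SDFPSolvable B) ∧
      (A.spectrahedron ⊆ B.spectrahedron ↔ IsPositiveMap (A.extendedMap B hA))) ∧
    -- if `S_A` is bounded, the extended pencil and the extended map can be replaced
    (∀ hA : LinearIndependent ℝ A.coeff, Bornology.IsBounded A.spectrahedron →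
      (A.SDFPSolvable B ↔ A.extend.SDFPSolvable B) ∧
      (A.SDFPSolvable B → IsCompletelyPositiveMap (A.coeffMap B hA)) ∧
      (ContainsPosDef A.extend.coeffSpan →
        IsCompletelyPositiveMap (A.coeffMap B hA) → A.SDFPSolvable B) ∧
      (A.spectrahedron ⊆ B.spectrahedron ↔ IsPositiveMap (A.coeffMap B hA))) := by
  have hfeas : A.extend.SDFPSolvable B ↔ ∃ lam : ℝ, 0 ≤ lam ∧ SosFeasible A B 0 lam :=
    sdfpSolvable_extend_iff_sosFeasible A B
  refine ⟨hfeas, fun h => ?_, sdfpSolvable_extend_of_zero_le_lambdaSos,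
    fun h t => zero_le_lambdaSos_mono t.zero_le h, zero_le_muMom_of_zero_le_lambdaSos r R,
    fun h t ht => zero_le_muMom_mono ht h, subset_of_zero_le_muMom hr hrR,
    LinearPencil.SDFPSolvable.extend, fun hA => ⟨fun h => h.isCompletelyPositiveMap _,
      fun hpos h => LinearPencil.sdfpSolvable_of_isCompletelyPositiveMap hpos h,
      LinearPencil.subset_iff_isPositiveMap_extendedMap B hne hA⟩,
    fun hA hb => ⟨⟨LinearPencil.SDFPSolvable.extend,
      LinearPencil.sdfpSolvable_of_extend hA hne hb⟩, fun h => h.isCompletelyPositiveMap hA,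
      fun hpos h => LinearPencil.sdfpSolvable_of_isCompletelyPositiveMap
        (LinearPencil.containsPosDef_of_extend hpos) h,
      LinearPencil.subset_iff_isPositiveMap_coeffMap B hne hb hA⟩⟩
  obtain ⟨lam, hlam, hf⟩ := hfeas.1 h
  exact zero_le_lambdaSos_of_feasible hlam hf
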